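/- Let $k$ be a field of characteristic zero. **Compermutations.** For $m\ge 0$ consider symbols $t\pi$, where $\pi=(\pi_1,\dots,\pi_r)$ is a pseudo-composition of $\{1,\dots,m\}$ (pairwise disjoint, possibly empty sets with union $\{1,\dots,m\}$) and $t$ is a planar binary rooted tree with $r$ leaves (for $r=0$, the tree without leaves). Two such symbols are equivalent if they become equal, both in the tree and in the tuple of sets, after all empty components of the pseudo-composition are deleted together with the corresponding leaves of the tree. The equivalence classes are the compermutations of weight $m$; let Ϭ be the set of all compermutations of all weights $m\ge 0$. Let $k[Ϭ]$ be the vector space with basis $\{\mathbf F_{t\pi} : t\pi\in Ϭ\}$, let $k[Ϭ]_m$ be the span of the $\mathbf F_{t\pi}$ of weight $m$, and for $t\pi$ of weight $m$ put $$\Delta(\mathbf F_{t\pi})=\sum_{p=0}^m \mathbf F_{t\,\pi|_{\{1,\dots,p\}}}\otimes \mathbf F_{t\,\mathrm{st}(\pi|_{\{p+1,\dots,m\}})},\qquad \epsilon(\mathbf F_{t\pi})=\begin{cases}1,& m=0,\\ 0,& m\ge 1,\end{cases}$$ where $\pi|_B=(\pi_1\cap B,\dots,\pi_r\cap B)$ and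 $\mathrm{st}$ subtracts $p$ from all elements. **Cofreeness.** Coalgebras are counital and coassociative. A grading of a coalgebra $C$ is a decomposition $C=\bigoplus_{n\ge0}C_n$ with $\Delta(C_n)\subseteq\sum_{i+j=n}C_i\otimes C_j$ and $\epsilon(C_n)=0$ for $n\ge1$; morphisms of graded coalgebras are the degree-preserving coalgebra morphisms. A graded coalgebra $C=\bigoplus_n C_n$ is *cofree* if for every graded coalgebra $D=\bigoplus_n D_n$ and every linear map $f\colon D\to C_1$ with $f(D_i)=0$ for $i\ne1$ there is a unique morphism of graded coalgebras $\hat f\colon D\to C$ with $p_1\hat f=f$, where $p_1\colon C\to C_1$ is the projection. **Statement.** $(k[Ϭ],\Delta,\epsilon)$ is a coassociative counital coalgebra, and it is cofree as a graded coassociative coalgebra in the following sense. There is a decomposition $k[Ϭ]=\bigoplus_{n\ge0}C_n$ into subspaces that are homogeneous for the weight, $C_n=\bigoplus_{m}(C_n\cap k[Ϭ]_m)$, such that: 1. $\bigoplus_{n} C_n$ is a grading of the coalgebra $(k[Ϭ],\Delta,\epsilon)$, and with this grading it is cofree; 2. $k[Ϭ]=\bigoplus_m k[Ϭ]_m$ is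 also a grading of the coalgebra, and with the weight grading $(k[Ϭ],\Delta,\epsilon)$ is the cofree graded coalgebra on the graded vector space $C_1=\bigoplus_m (C_1\cap k[Ϭ]_m)$: for every graded coalgebra $D=\bigoplus_m D_m$ and every linear map $f\colon D\to C_1$ with $f(D_m)\subseteq C_1\cap k[Ϭ]_m$ for all $m$ there is a unique morphism of graded coalgebras $\hat f\colon D\to k[Ϭ]$ (for the weight grading) with $p_1\hat f=f$, where $p_1\colon k[Ϭ]\to C_1$ is the projection along $\bigoplus_{n\ne1}C_n$. -/

import Mathlib

open scoped TensorProduct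

universe u v w

noncomputable section

/-! ## Graded coalgebras and cofreeness

`Coalgebra k C` is Mathlib's notion: counital and coassociative. -/

/-- `C = ⨁ 𝒞 n` is a grading of the coalgebra `C`:
`Δ (𝒞 n) ⊆ ∑_{i + j = n} 𝒞 i ⊗ 𝒞 j`, and the counit vanishes on `𝒞 n` for `n ≥ 1`. -/
structure IsGradedCoalgebra (k : Type u) {C : Type v} [Field k] [AddCommGroup C] [Module k C]
    [Coalgebra k C] (𝒞 : ℕ → Submodule k C) : Prop where
  isInternal : DirectSum.IsInternal 𝒞
  comul_mem : ∀ n : ℕ, ∀ c ∈ 𝒞 n, Coalgebra.comul (R := k) c ∈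
    ⨆ ij ∈ Finset.HasAntidiagonal.antidiagonal n,
      LinearMap.range (TensorProduct.map (𝒞 ij.1).subtype (𝒞 ij.2).subtype)
  counit_eq_zero : ∀ n : ℕ, n ≠ 0 → ∀ c ∈ 𝒞 n, Coalgebra.counit (R := k) c = 0

/-- The projection `p_n` of `C = ⨁ 𝒞 n` onto its homogeneous component `𝒞 n`. -/
def gradedProj {k : Type u} {C : Type v} [Field k] [AddCommGroup C] [Module k C]
    (𝒞 : ℕ → Submodule k C) (h : DirectSum.IsInternal 𝒞) (n : ℕ) : C →ₗ[k] 𝒞 n :=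
  DirectSum.component k ℕ (fun i => 𝒞 i) n ∘ₗ
    (LinearEquiv.ofBijective (DirectSum.coeLinearMap 𝒞) h).symm.toLinearMap

/-- A coalgebra morphism that respects the gradings. -/
def IsGradedHom {k : Type u} {D : Type w} {C : Type v} [Field k]
    [AddCommGroup D] [Module k D] [Coalgebra k D] [AddCommGroup C] [Module k C] [Coalgebra k C]
    (𝒟 : ℕ → Submodule k D) (𝒞 : ℕ → Submodule k C) (φ : D →ₗc[k] C) : Prop :=
  ∀ n : ℕ, ∀ d ∈ 𝒟 n, φ d ∈ 𝒞 n

/-- The graded coassociative coalgebra `C = ⨁ 𝒞 n` is cofree: for every graded coassociative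
coalgebra `D = ⨁ 𝒟 n`, every linear map `f : D → 𝒞 1` that vanishes on all `𝒟 i` with `i ≠ 1`
is `p_1 ∘ φ` for a unique morphism `φ : D → C` of graded coalgebras. -/
def IsCofreeGradedCoalgebra (k : Type u) {C : Type v} [Field k] [AddCommGroup C] [Module k C]
    [Coalgebra k C] (𝒞 : ℕ → Submodule k C) : Prop :=
  ∃ h : IsGradedCoalgebra k 𝒞,
    ∀ (D : Type w) [AddCommGroup D] [Module k D] [Coalgebra k D] (𝒟 : ℕ → Submodule k D),
      IsGradedCoalgebra k 𝒟 →
      ∀ f : D →ₗ[k] 𝒞 1, (∀ i : ℕ, i ≠ 1 → ∀ d ∈ 𝒟 i, f d = 0) →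
        ∃! φ : D →ₗc[k] C, IsGradedHom 𝒟 𝒞 φ ∧
          gradedProj 𝒞 h.isInternal 1 ∘ₗ (φ : D →ₗ[k] C) = f

/-- The graded coassociative coalgebra `C = ⨁ 𝒲 n` is cofree over its graded subspace
`V = ⨁ (V ⊓ 𝒲 n)`, with `p : C → V` as universal map: for every graded coassociative coalgebra
`D = ⨁ 𝒟 n`, every degree-preserving linear map `f : D → V` is `p ∘ φ` for a unique morphism
`φ : D → C` of graded coalgebras. -/
def IsCofreeGradedCoalgebraOver (k : Type u) {C : Type v} [Field k] [AddCommGroup C] [Module k C]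
    [Coalgebra k C] (𝒲 : ℕ → Submodule k C) (V : Submodule k C) (p : C →ₗ[k] V) : Prop :=
  IsGradedCoalgebra k 𝒲 ∧
    ∀ (D : Type w) [AddCommGroup D] [Module k D] [Coalgebra k D] (𝒟 : ℕ → Submodule k D),
      IsGradedCoalgebra k 𝒟 →
      ∀ f : D →ₗ[k] V, (∀ n : ℕ, ∀ d ∈ 𝒟 n, (f d : C) ∈ 𝒲 n) →
        ∃! φ : D →ₗc[k] C, IsGradedHom 𝒟 𝒲 φ ∧ p ∘ₗ (φ : D →ₗ[k] C) = f

/-! ## Labelled planar binary rooted trees -/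

/-- Planar binary rooted trees (those without leaves included) whose leaves are labelled from left
to right by elements of `α`, as monomials of the free unital magma on `α`: `1` is the tree
without leaves and the product is grafting. A planar binary tree with `r` leaves together with an
`r`-tuple of elements of `α` is the same thing as such a labelled tree. -/
abbrev LTree (α : Type) : Type := WithOne (FreeMagma α)

namespace LTree

/-- The tree with one leaf, labelled `a`. -/
def leaf {α : Type} (a : α) : LTree α := ((FreeMagma.of a : FreeMagma α) : WithOne (FreeMagma α))

/-- Extension of a map on leaves to all trees, compatible with grafting. -/
def lift {α M : Type} [MulOneClass M] (f : α → M) : LTree α →* M :=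
  WithOne.lift (FreeMagma.lift f)

/-- The tuple of the labels, from left to right. -/
def labels {α : Type} (x : LTree α) : List α :=
  FreeMonoid.toList (lift FreeMonoid.of x)

/-- Replace every label `a` by `f a`. -/
def relabel {α β : Type} (f : α → β) : LTree α →* LTree β :=
  lift fun a => leaf (f a)

/-- Remove all leaves that are labelled by the empty set. -/
def prune : LTree (Finset ℕ) →* LTree (Finset ℕ) :=
  lift fun A => if A = ∅ then 1 else leaf A

@[simp] theorem lift_leaf {α M : Type} [MulOneClass M] (f : α → M) (a : α) :
    lift f (leaf a) = f a := rfl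

theorem induction {α : Type} {P : LTree α → Prop} (h1 : P 1) (hl : ∀ a, P (leaf a))
    (hm : ∀ x y, P x → P y → P (x * y)) (x : LTree α) : P x := by
  induction x using WithOne.recOneCoe with
  | one => exact h1
  | coe x =>
    induction x with
    | ih1 a => exact hl a
    | ih2 a b ha hb =>
      rw [WithOne.coe_mul]
      exact hm _ _ ha hb

theorem labels_relabel {α β : Type} (f : α → β) (x : LTree α) :
    labels (relabel f x) = (labels x).map f := by
  induction x using LTree.induction with
  | h1 => simp [labels]
  | hl a => simp [labels, relabel]
  | hm x y hx hy =>
    simp only [labels, map_mul, FreeMonoid.toList_mul, List.map_append] at hx hy ⊢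
    rw [hx, hy]

theorem relabel_relabel {α β γ : Type} (f : α → β) (g : β → γ) (x : LTree α) :
    relabel g (relabel f x) = relabel (g ∘ f) x := by
  induction x using LTree.induction with
  | h1 => simp
  | hl a => simp [relabel]
  | hm x y hx hy => simp only [map_mul, hx, hy]

theorem relabel_congr {α β : Type} (f g : α → β) (x : LTree α)
    (h : ∀ a ∈ labels x, f a = g a) : relabel f x = relabel g x := by
  induction x using LTree.induction with
  | h1 => simp
  | hl a => simp [relabel, h a (by simp [labels])]
  | hm x y hx hy =>
    have e : labels (x * y) = labels x ++ labels y := by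
      simp [labels, map_mul, FreeMonoid.toList_mul]
    rw [map_mul, map_mul, hx fun a ha => h a (by simp [e, ha]),
      hy fun a ha => h a (by simp [e, ha])]

theorem relabel_id {α : Type} (x : LTree α) : relabel id x = x := by
  induction x using LTree.induction with
  | h1 => simp
  | hl a => simp [relabel]
  | hm x y hx hy => rw [map_mul, hx, hy]

theorem prune_relabel (f : Finset ℕ → Finset ℕ) (hf : f ∅ = ∅) (x : LTree (Finset ℕ)) :
    prune (relabel f (prune x)) = prune (relabel f x) := by
  induction x using LTree.induction with
  | h1 => simp
  | hl A =>
    by_cases hA : A = ∅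
    · simp [prune, relabel, hA, hf]
    · simp [prune, relabel, hA]
  | hm x y hx hy => simp only [map_mul, hx, hy]

theorem prune_eq_one (x : LTree (Finset ℕ)) (h : ∀ A ∈ labels x, A = ∅) : prune x = 1 := by
  induction x using LTree.induction with
  | h1 => simp
  | hl a => simp [prune, h a (by simp [labels])]
  | hm x y hx hy =>
    have e : labels (x * y) = labels x ++ labels y := by
      simp [labels, map_mul, FreeMonoid.toList_mul]
    rw [map_mul, hx fun a ha => h a (by simp [e, ha]),
      hy fun a ha => h a (by simp [e, ha]), one_mul]

end LTree

/-! ## Compermutations -/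

/-- A symbol `tπ`: a pseudo-composition `π = (π_1, …, π_r)` of the set `{1, …, m}` (pairwise
disjoint, possibly empty sets with union `{1, …, m}`) together with a planar binary rooted tree
`t` with `r` leaves. It is stored as the tree `t` with its leaves labelled by `π_1, …, π_r`. -/
structure CompSymbol where
  weight : ℕ
  tree : LTree (Finset ℕ)
  disjoint : tree.labels.Pairwise Disjoint
  mem_union : ∀ i : ℕ, (∃ A ∈ tree.labels, i ∈ A) ↔ 1 ≤ i ∧ i ≤ weight

/-- Intersection with `{1, …, p}`. -/
def initSet (p : ℕ) (A : Finset ℕ) : Finset ℕ := A.filter (· ≤ p)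

/-- Intersection with `{p + 1, p + 2, …}`, followed by subtraction of `p` from all elements. -/
def tailSet (p : ℕ) (A : Finset ℕ) : Finset ℕ := (A.filter (p < ·)).image (· - p)

theorem mem_initSet {p i : ℕ} {A : Finset ℕ} : i ∈ initSet p A ↔ i ∈ A ∧ i ≤ p := by
  simp [initSet]

theorem mem_tailSet {p i : ℕ} {A : Finset ℕ} : i ∈ tailSet p A ↔ 1 ≤ i ∧ i + p ∈ A := by
  simp only [tailSet, Finset.mem_image, Finset.mem_filter]
  constructor
  · rintro ⟨j, ⟨hj, hp⟩, rfl⟩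
    refine ⟨by omega, ?_⟩
    rwa [Nat.sub_add_cancel hp.le]
  · rintro ⟨h1, h2⟩
    exact ⟨i + p, ⟨h2, by omega⟩, by omega⟩

namespace CompSymbol

/-- Two symbols are equivalent if they are symbols for the same `{1, …, m}` and agree, both in the
tree and in the tuple of sets, after the empty sets are removed together with their leaves. -/
instance setoid : Setoid CompSymbol where
  r x y := x.weight = y.weight ∧ x.tree.prune = y.tree.prune
  iseqv := ⟨fun _ => ⟨rfl, rfl⟩, fun h => ⟨h.1.symm, h.2.symm⟩,
    fun h h' => ⟨h.1.trans h'.1, h.2.trans h'.2⟩⟩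

/-- `t π|_{1, …, p}` (which is `tπ` itself if `p` is at least the weight). -/
def init (p : ℕ) (x : CompSymbol) : CompSymbol where
  weight := min p x.weight
  tree := LTree.relabel (initSet p) x.tree
  disjoint := by
    rw [LTree.labels_relabel, List.pairwise_map]
    refine x.disjoint.imp fun {A B} h => ?_
    rw [Finset.disjoint_left] at h ⊢
    intro i hi hi'
    exact h (mem_initSet.1 hi).1 (mem_initSet.1 hi').1
  mem_union := by
    intro i
    have := x.mem_union i
    simp only [LTree.labels_relabel, List.mem_map, exists_exists_and_eq_and, mem_initSet]
    constructor
    · rintro ⟨A, hA, hi, hp⟩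
      have := this.1 ⟨A, hA, hi⟩
      omega
    · rintro ⟨h1, h2⟩
      obtain ⟨A, hA, hi⟩ := this.2 (by omega)
      exact ⟨A, hA, hi, by omega⟩

/-- `t st(π|_{p + 1, …, m})`. -/
def tail (p : ℕ) (x : CompSymbol) : CompSymbol where
  weight := x.weight - p
  tree := LTree.relabel (tailSet p) x.tree
  disjoint := by
    rw [LTree.labels_relabel, List.pairwise_map]
    refine x.disjoint.imp fun {A B} h => ?_
    rw [Finset.disjoint_left] at h ⊢
    intro i hi hi'
    exact h (mem_tailSet.1 hi).2 (mem_tailSet.1 hi').2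
  mem_union := by
    intro i
    have := x.mem_union (i + p)
    simp only [LTree.labels_relabel, List.mem_map, exists_exists_and_eq_and, mem_tailSet]
    constructor
    · rintro ⟨A, hA, h1, hi⟩
      have := this.1 ⟨A, hA, hi⟩
      omega
    · rintro ⟨h1, h2⟩
      obtain ⟨A, hA, hi⟩ := this.2 (by omega)
      exact ⟨A, hA, h1, hi⟩

end CompSymbol

/-- Compermutations: equivalence classes of symbols `tπ`. -/
def Comperm : Type := Quotient CompSymbol.setoid

namespace Comperm

/-- The number `m` such that the compermutation is one of `{1, …, m}`. -/
def weight : Comperm → ℕ := Quotient.lift CompSymbol.weight fun _ _ h => h.1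

/-- `tπ ↦ t π|_{1, …, p}`. -/
def init (p : ℕ) : Comperm → Comperm :=
  Quotient.map (CompSymbol.init p) fun x y h => by
    refine ⟨congrArg (min p) h.1, ?_⟩
    have e : initSet p ∅ = ∅ := by simp [initSet]
    change LTree.prune (LTree.relabel _ x.tree) = LTree.prune (LTree.relabel _ y.tree)
    rw [← LTree.prune_relabel _ e, ← LTree.prune_relabel _ e y.tree]
    exact congrArg (fun z => LTree.prune (LTree.relabel (initSet p) z)) h.2

/-- `tπ ↦ t st(π|_{p + 1, …, m})`. -/
def tail (p : ℕ) : Comperm → Comperm :=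
  Quotient.map (CompSymbol.tail p) fun x y h => by
    refine ⟨congrArg (· - p) h.1, ?_⟩
    have e : tailSet p ∅ = ∅ := by simp [tailSet]
    change LTree.prune (LTree.relabel _ x.tree) = LTree.prune (LTree.relabel _ y.tree)
    rw [← LTree.prune_relabel _ e, ← LTree.prune_relabel _ e y.tree]
    exact congrArg (fun z => LTree.prune (LTree.relabel (tailSet p) z)) h.2

theorem weight_init (p : ℕ) (c : Comperm) : (init p c).weight = min p c.weight := by
  induction c using Quotient.inductionOn with
  | h x => rfl

theorem weight_tail (p : ℕ) (c : Comperm) : (tail p c).weight = c.weight - p := by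
  induction c using Quotient.inductionOn with
  | h x => rfl

theorem eq_of_weight_eq_zero {c d : Comperm} (hc : c.weight = 0) (hd : d.weight = 0) : c = d := by
  induction c using Quotient.inductionOn with
  | h x =>
    induction d using Quotient.inductionOn with
    | h y =>
      have key : ∀ z : CompSymbol, z.weight = 0 → z.tree.prune = 1 := by
        intro z hz
        refine LTree.prune_eq_one _ fun A hA => ?_
        rw [Finset.eq_empty_iff_forall_notMem]
        intro i hi
        have := (z.mem_union i).1 ⟨A, hA, hi⟩
        omega
      refine Quotient.sound ⟨?_, ?_⟩
      · exact Eq.trans hc (Eq.symm hd)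
      · rw [key x hc, key y hd]

theorem init_weight (c : Comperm) : init c.weight c = c := by
  induction c using Quotient.inductionOn with
  | h x =>
    refine Quotient.sound ⟨min_self _, congrArg LTree.prune ?_⟩
    refine (LTree.relabel_congr _ id _ fun A hA => ?_).trans (LTree.relabel_id _)
    ext i
    rw [mem_initSet]
    exact ⟨fun h => h.1, fun h => ⟨h, ((x.mem_union i).1 ⟨A, hA, h⟩).2⟩⟩

theorem tail_zero (c : Comperm) : tail 0 c = c := by
  induction c using Quotient.inductionOn with
  | h x =>
    refine Quotient.sound ⟨Nat.sub_zero _, congrArg LTree.prune ?_⟩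
    refine (LTree.relabel_congr _ id _ fun A hA => ?_).trans (LTree.relabel_id _)
    ext i
    rw [mem_tailSet]
    exact ⟨fun h => h.2, fun h => ⟨((x.mem_union i).1 ⟨A, hA, h⟩).1, h⟩⟩

theorem init_init {p q : ℕ} (h : q ≤ p) (c : Comperm) : init q (init p c) = init q c := by
  induction c using Quotient.inductionOn with
  | h x =>
    refine Quotient.sound ⟨?_, congrArg LTree.prune ?_⟩
    · change min q (min p x.weight) = min q x.weight
      omega
    · refine (LTree.relabel_relabel _ _ _).trans (LTree.relabel_congr _ _ _ fun A _ => ?_)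
      ext i
      simp only [Function.comp, mem_initSet]
      exact ⟨fun h => ⟨h.1.1, h.2⟩, fun h => ⟨⟨h.1, by omega⟩, h.2⟩⟩

theorem tail_init (q r : ℕ) (c : Comperm) : tail q (init (q + r) c) = init r (tail q c) := by
  induction c using Quotient.inductionOn with
  | h x =>
    refine Quotient.sound ⟨?_, congrArg LTree.prune ?_⟩
    · change min (q + r) x.weight - q = min r (x.weight - q)
      omega
    · refine (LTree.relabel_relabel _ _ _).trans
        ((LTree.relabel_congr _ _ _ fun A _ => ?_).trans (LTree.relabel_relabel _ _ _).symm)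
      ext i
      simp only [Function.comp, mem_initSet, mem_tailSet]
      exact ⟨fun h => ⟨⟨h.1, h.2.1⟩, by omega⟩, fun h => ⟨h.1.1, h.1.2, by omega⟩⟩

theorem tail_tail (q r : ℕ) (c : Comperm) : tail r (tail q c) = tail (q + r) c := by
  induction c using Quotient.inductionOn with
  | h x =>
    refine Quotient.sound ⟨?_, congrArg LTree.prune ?_⟩
    · change x.weight - q - r = x.weight - (q + r)
      omega
    · refine (LTree.relabel_relabel _ _ _).trans (LTree.relabel_congr _ _ _ fun A _ => ?_)
      ext i
      simp only [Function.comp, mem_tailSet, add_assoc, add_comm q r]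
      exact ⟨fun h => ⟨h.1, h.2.2⟩, fun h => ⟨h.1, by omega, h.2⟩⟩

end Comperm

/-! ## The coalgebra of compermutations -/

/-- The vector space with basis the set of all compermutations. -/
def CompermSpace (k : Type u) [Field k] : Type u := Comperm →₀ k

namespace CompermSpace

instance (k : Type u) [Field k] : AddCommGroup (CompermSpace k) :=
  inferInstanceAs (AddCommGroup (Comperm →₀ k))

instance (k : Type u) [Field k] : Module k (CompermSpace k) :=
  inferInstanceAs (Module k (Comperm →₀ k))

/-- The basis `F_{tπ}`. -/
def basis (k : Type u) [Field k] : Module.Basis Comperm k (CompermSpace k) :=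
  Module.Basis.ofRepr (LinearEquiv.refl k (Comperm →₀ k))

/-- `Δ F_{tπ} = ∑_{p = 0}^m F_{t π|_{1, …, p}} ⊗ F_{t st(π|_{p + 1, …, m})}` for `tπ` of weight
`m`; `ε F_{tπ}` is `1` if `tπ` has weight `0` and `0` otherwise. -/
instance (k : Type u) [Field k] : CoalgebraStruct k (CompermSpace k) where
  comul := (basis k).constr k fun c =>
    ∑ p ∈ Finset.range (c.weight + 1), basis k (c.init p) ⊗ₜ[k] basis k (c.tail p)
  counit := (basis k).constr k fun c => if c.weight = 0 then 1 else 0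

theorem comul_basis (k : Type u) [Field k] (c : Comperm) :
    CoalgebraStruct.comul (R := k) (basis k c) =
      ∑ p ∈ Finset.range (c.weight + 1), basis k (c.init p) ⊗ₜ[k] basis k (c.tail p) :=
  Module.Basis.constr_basis _ _ _ _

theorem counit_basis (k : Type u) [Field k] (c : Comperm) :
    CoalgebraStruct.counit (R := k) (basis k c) = if c.weight = 0 then 1 else 0 :=
  Module.Basis.constr_basis _ _ _ _

instance (k : Type u) [Field k] : Coalgebra k (CompermSpace k) where
  coassoc := by
    refine (basis k).ext fun c => ?_
    simp only [LinearMap.comp_apply, LinearEquiv.coe_coe, comul_basis, map_sum,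
      LinearMap.rTensor_tmul, LinearMap.lTensor_tmul, TensorProduct.sum_tmul,
      TensorProduct.tmul_sum, TensorProduct.assoc_tmul, Comperm.weight_init, Comperm.weight_tail]
    rw [Finset.sum_sigma', Finset.sum_sigma']
    refine Finset.sum_bij' (fun x _ => ⟨x.2, x.1 - x.2⟩) (fun x _ => ⟨x.1 + x.2, x.1⟩)
      ?_ ?_ ?_ ?_ ?_
    · rintro ⟨p, q⟩ h
      simp only [Finset.mem_sigma, Finset.mem_range] at h ⊢
      omega
    · rintro ⟨q, r⟩ h
      simp only [Finset.mem_sigma, Finset.mem_range] at h ⊢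
      omega
    · rintro ⟨p, q⟩ h
      simp only [Finset.mem_sigma, Finset.mem_range] at h
      simp only [Sigma.mk.injEq, heq_eq_eq, and_true]
      omega
    · rintro ⟨q, r⟩ h
      simp only [Sigma.mk.injEq, heq_eq_eq, true_and]
      omega
    · rintro ⟨p, q⟩ h
      simp only [Finset.mem_sigma, Finset.mem_range] at h
      obtain ⟨r, rfl⟩ : ∃ r, p = q + r := ⟨p - q, by omega⟩
      simp only [Nat.add_sub_cancel_left, Comperm.init_init (Nat.le_add_right q r),
        Comperm.tail_init, Comperm.tail_tail]
  rTensor_counit_comp_comul := by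
    refine (basis k).ext fun c => ?_
    simp only [LinearMap.comp_apply, comul_basis, map_sum, LinearMap.rTensor_tmul, counit_basis,
      TensorProduct.mk_apply, Comperm.weight_init]
    rw [Finset.sum_eq_single 0]
    · simp [Comperm.tail_zero]
    · intro p hp hp0
      rw [Finset.mem_range] at hp
      rw [if_neg (by omega), TensorProduct.zero_tmul]
    · simp
  lTensor_counit_comp_comul := by
    refine (basis k).ext fun c => ?_
    simp only [LinearMap.comp_apply, comul_basis, map_sum, LinearMap.lTensor_tmul, counit_basis,
      LinearMap.flip_apply, TensorProduct.mk_apply, Comperm.weight_tail]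
    rw [Finset.sum_eq_single c.weight]
    · simp [Comperm.init_weight]
    · intro p hp hp0
      rw [Finset.mem_range] at hp
      rw [if_neg (by omega), TensorProduct.tmul_zero]
    · simp

/-- The homogeneous component of weight `m`: the span of the `F_{tπ}` with `tπ` a compermutation
of `{1, …, m}`. -/
def weightPart (k : Type u) [Field k] (m : ℕ) : Submodule k (CompermSpace k) :=
  Submodule.span k (basis k '' {c : Comperm | c.weight = m})

end CompermSpace

end

/-!
The coalgebra of compermutations is cofree because it carries a product that makes it a connected
unital infinitesimal magmatic bialgebra. The product `F_c * F_d` is the basis element of the graft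
of `c` with the translate of `d`. It is unital but not associative; a cut of the graft is a cut of
`c` or a cut of `d`, which gives
`Δ(x * y) = (id ⊗ (- * y)) Δ(x) + ((x * -) ⊗ id) Δ(y) - x ⊗ y` (`CompermSpace.comul_mul`).
In particular `Δ(v * y) = 1 ⊗ v * y + ((v * -) ⊗ id) Δ(y)` for primitive `v`, so right-normed
products `v₁ * (v₂ * (⋯ * vₙ))` of primitive elements are deconcatenated by `Δ`.

The recursion `x = ε(x) 1 + ∑ e(x₁) * x₂` defines a linear map `e` (`CompermSpace.primProj`). Its
values are primitive (`primProj_mem_prim`) and `e(v * y) = ε(y) v` for primitive `v`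
(`primProj_mul`). Hence right-normed products of primitive elements span the whole space, and the
convolution powers `π₀ = ε(-) 1`, `πₙ₊₁(x) = ∑ e(x₁) * πₙ(x₂)` are projections onto the spans
`𝒞 n` of the products with `n` factors, which proves that the sum of the `𝒞 n` is direct. All of
this respects the weight.

For a graded coalgebra `D` and a linear map `f` from `D` to the primitive elements with `f = 0` in
degree `0`, the equation `φ(d) = ε(d) 1 + ∑ f(d₁) * φ(d₂)` has exactly one solution `φ`, since its
right-hand side in degree `n` involves `φ` only in degrees less than `n`
(`IsGradedCoalgebra.exists_fixedPoint`, `IsGradedCoalgebra.fixedPoint_unique`). A coalgebra morphism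
`φ` with `e ∘ φ = f` satisfies this equation (`coalgHom_eq_conv`). Conversely the solution is a
coalgebra morphism, because `Δ ∘ φ` and `(φ ⊗ φ) ∘ Δ` solve one and the same equation of this type
(`map_comp_comul_of_eq_conv`). The solution respects a grading as soon as left multiplication by
the values of `f` does; this gives the universal property for the grading by the number of
primitive factors and for the grading by weight at once (`existsUnique_coalgHom`).
-/

noncomputable section

/-! ### Grafting of compermutations -/

/-- Translation of a finite set by `p`. -/
def shiftSet (p : ℕ) (A : Finset ℕ) : Finset ℕ := A.image (· + p)

theorem mem_shiftSet {p i : ℕ} {A : Finset ℕ} : i ∈ shiftSet p A ↔ p ≤ i ∧ i - p ∈ A := by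
  simp only [shiftSet, Finset.mem_image]
  constructor
  · rintro ⟨j, hj, rfl⟩
    exact ⟨by omega, by simpa using hj⟩
  · rintro ⟨h, h'⟩
    exact ⟨i - p, h', by omega⟩

theorem LTree.labels_mul {α : Type} (x y : LTree α) : (x * y).labels = x.labels ++ y.labels := by
  simp [LTree.labels, map_mul, FreeMonoid.toList_mul]

theorem LTree.mem_labels_one {α : Type} (a : α) : ¬ a ∈ (1 : LTree α).labels := by
  simp [LTree.labels]

namespace CompSymbol

theorem le_weight (x : CompSymbol) {A : Finset ℕ} (hA : A ∈ x.tree.labels) {i : ℕ} (hi : i ∈ A) :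
    1 ≤ i ∧ i ≤ x.weight :=
  (x.mem_union i).1 ⟨A, hA, hi⟩

/-- The two trees are grafted onto a new root; the labels of the second one are translated by the
weight of the first one. -/
def graft (x y : CompSymbol) : CompSymbol where
  weight := x.weight + y.weight
  tree := x.tree * LTree.relabel (shiftSet x.weight) y.tree
  disjoint := by
    rw [LTree.labels_mul, LTree.labels_relabel, List.pairwise_append, List.pairwise_map]
    refine ⟨x.disjoint, y.disjoint.imp fun {A B} h => ?_, fun A hA B hB => ?_⟩
    · rw [Finset.disjoint_left] at h ⊢
      intro i hi hi'
      exact h (mem_shiftSet.1 hi).2 (mem_shiftSet.1 hi').2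
    · obtain ⟨B, hB', rfl⟩ := List.mem_map.1 hB
      rw [Finset.disjoint_left]
      intro i hi hi'
      rw [mem_shiftSet] at hi'
      have := x.le_weight hA hi
      have := y.le_weight hB' hi'.2
      omega
  mem_union := by
    intro i
    have h1 := x.mem_union i
    have h2 := y.mem_union (i - x.weight)
    simp only [LTree.labels_mul, LTree.labels_relabel, List.mem_append, List.mem_map]
    constructor
    · rintro ⟨A, hA | ⟨B, hB, rfl⟩, hi⟩
      · have := x.le_weight hA hi
        omega
      · rw [mem_shiftSet] at hi
        have := y.le_weight hB hi.2
        omega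
    · rintro ⟨hi1, hi2⟩
      by_cases hi : i ≤ x.weight
      · obtain ⟨A, hA, hiA⟩ := h1.2 ⟨hi1, hi⟩
        exact ⟨A, Or.inl hA, hiA⟩
      · obtain ⟨A, hA, hiA⟩ := h2.2 (by omega)
        exact ⟨_, Or.inr ⟨A, hA, rfl⟩, mem_shiftSet.2 ⟨by omega, hiA⟩⟩

/-- The symbol of weight `0` with the tree without leaves. -/
def empty : CompSymbol where
  weight := 0
  tree := 1
  disjoint := by simp [LTree.labels]
  mem_union := by
    intro i
    simp only [LTree.mem_labels_one, false_and, exists_false, false_iff]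
    omega

end CompSymbol

namespace Comperm

/-- Grafting of compermutations; the letters of the second factor are translated by the weight of
the first. -/
def graft : Comperm → Comperm → Comperm :=
  Quotient.map₂ CompSymbol.graft fun x x' h y y' h' => by
    refine ⟨congrArg₂ (· + ·) h.1 h'.1, ?_⟩
    have e : shiftSet x.weight ∅ = ∅ := by simp [shiftSet]
    change LTree.prune (x.tree * LTree.relabel (shiftSet x.weight) y.tree) =
      LTree.prune (x'.tree * LTree.relabel (shiftSet x'.weight) y'.tree)
    rw [map_mul, map_mul, ← h.1, ← LTree.prune_relabel _ e, ← LTree.prune_relabel _ e y'.tree,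
      h.2, h'.2]

/-- The compermutation of weight `0`. -/
def empty : Comperm := Quotient.mk _ CompSymbol.empty

theorem weight_empty : empty.weight = 0 := rfl

theorem eq_empty_iff {c : Comperm} : c = empty ↔ c.weight = 0 :=
  ⟨fun h => h ▸ rfl, fun h => eq_of_weight_eq_zero h rfl⟩

theorem weight_graft (c d : Comperm) : (graft c d).weight = c.weight + d.weight := by
  induction c using Quotient.inductionOn
  induction d using Quotient.inductionOn
  rfl

theorem empty_graft (d : Comperm) : graft empty d = d := by
  induction d using Quotient.inductionOn with
  | h y =>
    refine Quotient.sound ⟨Nat.zero_add _, congrArg LTree.prune ?_⟩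
    refine (one_mul _).trans ((LTree.relabel_congr _ id _ fun A _ => ?_).trans (LTree.relabel_id _))
    ext i
    simp [mem_shiftSet, CompSymbol.empty]

theorem graft_empty (c : Comperm) : graft c empty = c := by
  induction c using Quotient.inductionOn with
  | h x => exact Quotient.sound ⟨Nat.add_zero _, congrArg LTree.prune (mul_one x.tree)⟩

theorem init_graft_of_le {p : ℕ} {c : Comperm} (h : p ≤ c.weight) (d : Comperm) :
    init p (graft c d) = init p c := by
  induction c using Quotient.inductionOn with
  | h x =>
    induction d using Quotient.inductionOn with
    | h y =>
      change p ≤ x.weight at h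
      refine Quotient.sound ⟨?_, ?_⟩
      · change min p (x.weight + y.weight) = min p x.weight
        omega
      · change LTree.prune (LTree.relabel _ (x.tree * LTree.relabel _ y.tree)) = _
        rw [map_mul, map_mul, LTree.relabel_relabel, LTree.prune_eq_one (LTree.relabel _ y.tree),
          mul_one]
        · rfl
        · intro A hA
          rw [LTree.labels_relabel, List.mem_map] at hA
          obtain ⟨B, hB, rfl⟩ := hA
          rw [Finset.eq_empty_iff_forall_notMem]
          intro i hi
          rw [Function.comp, mem_initSet, mem_shiftSet] at hi
          have := y.le_weight hB hi.1.2
          omega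

theorem init_graft_add (c d : Comperm) (q : ℕ) :
    init (c.weight + q) (graft c d) = graft c (init q d) := by
  induction c using Quotient.inductionOn with
  | h x =>
    induction d using Quotient.inductionOn with
    | h y =>
      refine Quotient.sound ⟨?_, congrArg LTree.prune ?_⟩
      · change min (x.weight + q) (x.weight + y.weight) = x.weight + min q y.weight
        omega
      · change LTree.relabel (initSet (x.weight + q)) (x.tree * LTree.relabel _ y.tree) =
          x.tree * LTree.relabel _ (LTree.relabel _ y.tree)
        rw [map_mul, LTree.relabel_relabel, LTree.relabel_relabel]
        congr 1
        · refine (LTree.relabel_congr _ id _ fun A hA => ?_).trans (LTree.relabel_id _)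
          ext i
          rw [mem_initSet]
          exact ⟨fun h => h.1, fun h => ⟨h, by have := x.le_weight hA h; omega⟩⟩
        · refine LTree.relabel_congr _ _ _ fun A _ => ?_
          ext i
          simp only [Function.comp, mem_initSet, mem_shiftSet]
          exact ⟨fun h => ⟨h.1.1, h.1.2, by omega⟩, fun h => ⟨⟨h.1, h.2.1⟩, by omega⟩⟩

theorem tail_graft_of_le {p : ℕ} {c : Comperm} (h : p ≤ c.weight) (d : Comperm) :
    tail p (graft c d) = graft (tail p c) d := by
  induction c using Quotient.inductionOn with
  | h x =>
    induction d using Quotient.inductionOn with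
    | h y =>
      change p ≤ x.weight at h
      refine Quotient.sound ⟨?_, congrArg LTree.prune ?_⟩
      · change x.weight + y.weight - p = x.weight - p + y.weight
        omega
      · change LTree.relabel (tailSet p) (x.tree * LTree.relabel _ y.tree) =
          LTree.relabel _ x.tree * LTree.relabel (shiftSet (x.weight - p)) y.tree
        rw [map_mul, LTree.relabel_relabel]
        congr 1
        refine LTree.relabel_congr _ _ _ fun A hA => ?_
        ext i
        simp only [Function.comp, mem_tailSet, mem_shiftSet]
        have e : i + p - x.weight = i - (x.weight - p) := by omega
        rw [e]
        constructor
        · exact fun h => ⟨by omega, h.2.2⟩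
        · intro h
          have := y.le_weight hA h.2
          exact ⟨by omega, by omega, h.2⟩

theorem tail_graft_add (c d : Comperm) (q : ℕ) :
    tail (c.weight + q) (graft c d) = tail q d := by
  induction c using Quotient.inductionOn with
  | h x =>
    induction d using Quotient.inductionOn with
    | h y =>
      refine Quotient.sound ⟨?_, ?_⟩
      · change x.weight + y.weight - (x.weight + q) = y.weight - q
        omega
      · change LTree.prune (LTree.relabel (tailSet (x.weight + q))
          (x.tree * LTree.relabel _ y.tree)) = LTree.prune (LTree.relabel _ y.tree)
        rw [map_mul, map_mul, LTree.relabel_relabel, LTree.prune_eq_one (LTree.relabel _ x.tree),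
          one_mul]
        · refine congrArg LTree.prune (LTree.relabel_congr _ _ _ fun A _ => ?_)
          ext i
          simp only [Function.comp, mem_tailSet, mem_shiftSet]
          have e : i + (x.weight + q) - x.weight = i + q := by omega
          rw [e]
          exact ⟨fun h => ⟨h.1, h.2.2⟩, fun h => ⟨h.1, by omega, h.2⟩⟩
        · intro A hA
          rw [LTree.labels_relabel, List.mem_map] at hA
          obtain ⟨B, hB, rfl⟩ := hA
          rw [Finset.eq_empty_iff_forall_notMem]
          intro i hi
          rw [mem_tailSet] at hi
          have := x.le_weight hB hi.2
          omega

theorem init_zero (c : Comperm) : init 0 c = empty :=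
  eq_empty_iff.2 (by rw [weight_init]; omega)

theorem tail_weight (c : Comperm) : tail c.weight c = empty :=
  eq_empty_iff.2 (by rw [weight_tail]; omega)

end Comperm

/-! ### Direct sum decompositions -/

section Decomposition

variable {k : Type u} [Field k] {X : Type v} [AddCommGroup X] [Module k X]

theorem DirectSum.IsInternal.symm_apply_of_mem {𝒟 : ℕ → Submodule k X}
    (h : DirectSum.IsInternal 𝒟) {n : ℕ} {x : X} (hx : x ∈ 𝒟 n) :
    (LinearEquiv.ofBijective (DirectSum.coeLinearMap 𝒟) h).symm x =
      DirectSum.lof k ℕ (fun i => 𝒟 i) n ⟨x, hx⟩ :=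
  (LinearEquiv.symm_apply_eq _).2 (DirectSum.coeLinearMap_lof 𝒟 n ⟨x, hx⟩).symm

theorem DirectSum.IsInternal.mem_of_forall_le {𝒟 : ℕ → Submodule k X}
    (h : DirectSum.IsInternal 𝒟) {P : Submodule k X} (hP : ∀ n, 𝒟 n ≤ P) (x : X) : x ∈ P := by
  have := iSup_le hP
  rw [h.submodule_iSup_eq_top] at this
  exact this trivial

/-- A family of submodules that spans and carries a dual family of projections is a direct sum
decomposition. -/
theorem DirectSum.isInternal_of_projections {𝒞 : ℕ → Submodule k X} (π : ℕ → X →ₗ[k] X)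
    (hπ : ∀ n, ∀ x ∈ 𝒞 n, π n x = x) (hπ' : ∀ n m, n ≠ m → ∀ x ∈ 𝒞 m, π n x = 0)
    (htop : ⨆ n, 𝒞 n = ⊤) : DirectSum.IsInternal 𝒞 := by
  have key : ∀ n, π n ∘ₗ DirectSum.coeLinearMap 𝒞 =
      (𝒞 n).subtype ∘ₗ DirectSum.component k ℕ (fun i => 𝒞 i) n := by
    intro n
    refine DirectSum.linearMap_ext k fun m => LinearMap.ext fun x => ?_
    simp only [LinearMap.comp_apply, DirectSum.coeLinearMap_lof]
    by_cases hnm : n = m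
    · subst hnm
      rw [DirectSum.component.lof_self, hπ n x x.2, Submodule.subtype_apply]
    · rw [hπ' n m hnm x x.2, DirectSum.component.of, dif_neg (Ne.symm hnm), map_zero]
  constructor
  · refine (injective_iff_map_eq_zero (DirectSum.coeLinearMap 𝒞)).2 fun x hx => ?_
    refine DirectSum.ext_component k fun n => Subtype.ext ?_
    have := LinearMap.congr_fun (key n) x
    rw [LinearMap.comp_apply, hx, map_zero] at this
    rw [map_zero]
    exact this.symm
  · change Function.Surjective (DirectSum.coeLinearMap 𝒞)
    rw [← LinearMap.range_eq_top, ← htop]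
    exact (Submodule.iSup_eq_range_dfinsupp_lsum 𝒞).symm

theorem gradedProj_eq {𝒞 : ℕ → Submodule k X}
    (h : DirectSum.IsInternal 𝒞) {n : ℕ} {p : X →ₗ[k] X} (hp : ∀ x ∈ 𝒞 n, p x = x)
    (hp' : ∀ m, n ≠ m → ∀ x ∈ 𝒞 m, p x = 0) :
    (𝒞 n).subtype ∘ₗ gradedProj 𝒞 h n = p := by
  have hd : ∀ m, ∀ x ∈ 𝒞 m, (gradedProj 𝒞 h n x : X) = p x := by
    intro m x hx
    have : (LinearEquiv.ofBijective (DirectSum.coeLinearMap 𝒞) h).symm x =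
        DirectSum.lof k ℕ (fun i => 𝒞 i) m ⟨x, hx⟩ :=
      h.symm_apply_of_mem hx
    simp only [gradedProj, LinearMap.comp_apply, LinearEquiv.coe_coe, this]
    by_cases hnm : n = m
    · subst hnm
      rw [DirectSum.component.lof_self, hp x hx]
    · rw [hp' m hnm x hx, DirectSum.component.of, dif_neg (Ne.symm hnm), Submodule.coe_zero]
  rw [← sub_eq_zero]
  ext x
  exact h.mem_of_forall_le
    (P := LinearMap.ker ((𝒞 n).subtype ∘ₗ gradedProj 𝒞 h n - p))
    (fun m y hy => by simp [hd m y hy]) x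

theorem tmul_mem_iSup_antidiagonal {𝒞 : ℕ → Submodule k X} {i j n : ℕ} (h : i + j = n)
    {x y : X} (hx : x ∈ 𝒞 i) (hy : y ∈ 𝒞 j) :
    x ⊗ₜ[k] y ∈ ⨆ ij ∈ Finset.HasAntidiagonal.antidiagonal n,
      LinearMap.range (TensorProduct.map (𝒞 ij.1).subtype (𝒞 ij.2).subtype) :=
  Submodule.mem_iSup_of_mem (i, j) (Submodule.mem_iSup_of_mem
    (Finset.HasAntidiagonal.mem_antidiagonal.2 h) ⟨⟨x, hx⟩ ⊗ₜ[k] ⟨y, hy⟩, rfl⟩)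

theorem iSup_antidiagonal_le {𝒞 : ℕ → Submodule k X} {n : ℕ} {P : Submodule k (X ⊗[k] X)}
    (h : ∀ i j, i + j = n → ∀ x ∈ 𝒞 i, ∀ y ∈ 𝒞 j, x ⊗ₜ[k] y ∈ P) :
    ⨆ ij ∈ Finset.HasAntidiagonal.antidiagonal n,
      LinearMap.range (TensorProduct.map (𝒞 ij.1).subtype (𝒞 ij.2).subtype) ≤ P := by
  refine iSup₂_le fun ij hij => ?_
  rintro _ ⟨t, rfl⟩
  induction t with
  | zero => simp
  | add x y hx hy => rw [map_add]; exact add_mem hx hy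
  | tmul x y => exact h ij.1 ij.2 (Finset.HasAntidiagonal.mem_antidiagonal.1 hij) x x.2 y y.2

end Decomposition

/-! ### Convolution and recursion along a grading -/

section Convolution

open Coalgebra

variable {k : Type u} [Field k] {D : Type v} [AddCommGroup D] [Module k D] [Coalgebra k D]
  {X Y Z : Type*} [AddCommGroup X] [Module k X] [AddCommGroup Y] [Module k Y]
  [AddCommGroup Z] [Module k Z]

/-- The convolution `d ↦ ∑ A d₁ (G d₂)` of linear maps out of a coalgebra, along the evaluation of
linear maps `X → Y` at elements of `X`. -/
def conv (A : D →ₗ[k] X →ₗ[k] Y) (G : D →ₗ[k] X) : D →ₗ[k] Y :=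
  TensorProduct.lift (A.compl₂ G) ∘ₗ comul

theorem conv_add_right (A : D →ₗ[k] X →ₗ[k] Y) (G G' : D →ₗ[k] X) :
    conv A (G + G') = conv A G + conv A G' := by
  have : TensorProduct.lift (A.compl₂ (G + G')) =
      TensorProduct.lift (A.compl₂ G) + TensorProduct.lift (A.compl₂ G') :=
    TensorProduct.ext' fun a b => by simp
  rw [conv, this, LinearMap.add_comp, conv, conv]

theorem conv_add_left (A A' : D →ₗ[k] X →ₗ[k] Y) (G : D →ₗ[k] X) :
    conv (A + A') G = conv A G + conv A' G := by
  have : TensorProduct.lift ((A + A').compl₂ G) =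
      TensorProduct.lift (A.compl₂ G) + TensorProduct.lift (A'.compl₂ G) :=
    TensorProduct.ext' fun a b => by simp
  rw [conv, this, LinearMap.add_comp, conv, conv]

theorem conv_sub_right (A : D →ₗ[k] X →ₗ[k] Y) (G G' : D →ₗ[k] X) :
    conv A (G - G') = conv A G - conv A G' :=
  eq_sub_of_add_eq (by rw [← conv_add_right, sub_add_cancel])

theorem comp_conv (g : Y →ₗ[k] Z) (A : D →ₗ[k] X →ₗ[k] Y) (G : D →ₗ[k] X) :
    g ∘ₗ conv A G = conv (A.compr₂ g) G := by
  rw [conv, conv, ← LinearMap.comp_assoc]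
  congr 1
  exact TensorProduct.ext' fun a b => by simp

theorem conv_eq_of_counit_left {A : D →ₗ[k] X →ₗ[k] Y} {G : D →ₗ[k] X} {g : D →ₗ[k] Y}
    (h : ∀ a b, A a (G b) = counit (R := k) a • g b) : conv A G = g := by
  have e : TensorProduct.lift (A.compl₂ G) =
      (TensorProduct.lid k Y).toLinearMap ∘ₗ g.lTensor k ∘ₗ counit.rTensor D :=
    TensorProduct.ext' fun a b => by simp [h]
  ext d
  rw [conv, e]
  simp only [LinearMap.comp_apply, LinearEquiv.coe_coe, rTensor_counit_comul]
  simp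

theorem conv_eq_of_counit_right {A : D →ₗ[k] X →ₗ[k] Y} {G : D →ₗ[k] X} {g : D →ₗ[k] Y}
    (h : ∀ a b, A a (G b) = counit (R := k) b • g a) : conv A G = g := by
  have e : TensorProduct.lift (A.compl₂ G) =
      (TensorProduct.rid k Y).toLinearMap ∘ₗ g.rTensor k ∘ₗ counit.lTensor D :=
    TensorProduct.ext' fun a b => by simp [h]
  ext d
  rw [conv, e]
  simp only [LinearMap.comp_apply, LinearEquiv.coe_coe, lTensor_counit_comul]
  simp

theorem conv_comp_coalgHom {C : Type*} [AddCommGroup C] [Module k C] [Coalgebra k C]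
    (A : C →ₗ[k] X →ₗ[k] Y) (G : C →ₗ[k] X) (φ : D →ₗc[k] C) :
    conv A G ∘ₗ (φ : D →ₗ[k] C) =
      conv (A ∘ₗ (φ : D →ₗ[k] C)) (G ∘ₗ (φ : D →ₗ[k] C)) := by
  have e : TensorProduct.lift ((A ∘ₗ (φ : D →ₗ[k] C)).compl₂ (G ∘ₗ (φ : D →ₗ[k] C))) =
      TensorProduct.lift (A.compl₂ G) ∘ₗ TensorProduct.map (φ : D →ₗ[k] C) (φ : D →ₗ[k] C) :=
    TensorProduct.ext' fun a b => by simp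
  rw [conv, conv, e, LinearMap.comp_assoc, LinearMap.comp_assoc]
  congr 1
  exact φ.map_comp_comul.symm

/-- Coassociativity, in terms of `conv`. -/
theorem conv_mk_conv (A : D →ₗ[k] X →ₗ[k] Y) (G : D →ₗ[k] X) (H : D →ₗ[k] Z) :
    conv (TensorProduct.mk k Y Z ∘ₗ conv A G) H =
      conv (LinearMap.rTensorHom Z ∘ₗ A) (conv (TensorProduct.mk k X Z ∘ₗ G) H) := by
  have e1 : TensorProduct.lift ((TensorProduct.mk k Y Z ∘ₗ conv A G).compl₂ H) =
      TensorProduct.map (TensorProduct.lift (A.compl₂ G)) H ∘ₗ comul.rTensor D :=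
    TensorProduct.ext' fun a b => by simp [conv]
  have e2 : TensorProduct.lift ((LinearMap.rTensorHom Z ∘ₗ A).compl₂
        (conv (TensorProduct.mk k X Z ∘ₗ G) H)) =
      TensorProduct.map (TensorProduct.lift (A.compl₂ G)) H ∘ₗ
        (TensorProduct.assoc k D D D).symm.toLinearMap ∘ₗ comul.lTensor D := by
    refine TensorProduct.ext' fun a b => ?_
    simp only [conv, TensorProduct.lift.tmul, LinearMap.compl₂_apply, LinearMap.comp_apply,
      LinearMap.lTensor_tmul, LinearEquiv.coe_coe, LinearMap.coe_rTensorHom]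
    induction comul (R := k) b with
    | zero => simp
    | add x y hx hy => simp only [map_add, TensorProduct.tmul_add, hx, hy]
    | tmul x y => simp
  change TensorProduct.lift _ ∘ₗ comul = TensorProduct.lift _ ∘ₗ comul
  rw [e1, e2, LinearMap.comp_assoc, LinearMap.comp_assoc, LinearMap.comp_assoc,
    Coalgebra.coassoc_symm]

theorem map_comp_comul_eq_conv (G : D →ₗ[k] X) (H : D →ₗ[k] Y) :
    TensorProduct.map G H ∘ₗ comul = conv (TensorProduct.mk k X Y ∘ₗ G) H := by
  have e : TensorProduct.lift ((TensorProduct.mk k X Y ∘ₗ G).compl₂ H) = TensorProduct.map G H :=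
    TensorProduct.ext' fun a b => by simp
  rw [conv, e]

theorem IsGradedCoalgebra.conv_mem {𝒟 : ℕ → Submodule k D} (h : IsGradedCoalgebra k 𝒟)
    {A : D →ₗ[k] X →ₗ[k] Y} {G : D →ₗ[k] X} {P : Submodule k Y} {n : ℕ} {d : D} (hd : d ∈ 𝒟 n)
    (hP : ∀ i j, i + j = n → ∀ a ∈ 𝒟 i, ∀ b ∈ 𝒟 j, A a (G b) ∈ P) : conv A G d ∈ P := by
  refine Submodule.mem_comap.1 (iSup_antidiagonal_le (P := P.comap (TensorProduct.lift _))
    (fun i j hij a ha b hb => ?_) (h.comul_mem n d hd))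
  simpa using hP i j hij a ha b hb

/-- If `A` vanishes in degree `0`, then `conv A G` in degree `n` only involves `G` in degrees less
than `n`. -/
theorem IsGradedCoalgebra.conv_eq_zero {𝒟 : ℕ → Submodule k D} (h : IsGradedCoalgebra k 𝒟)
    {A : D →ₗ[k] X →ₗ[k] Y} (hA : ∀ d ∈ 𝒟 0, A d = 0) {G : D →ₗ[k] X} {n : ℕ}
    (hG : ∀ j < n, ∀ b ∈ 𝒟 j, G b = 0) {d : D} (hd : d ∈ 𝒟 n) : conv A G d = 0 := by
  refine (Submodule.mem_bot k).1 (h.conv_mem hd fun i j hij a ha b hb => ?_)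
  rw [Submodule.mem_bot]
  rcases Nat.eq_zero_or_pos i with rfl | hi
  · rw [hA a ha, LinearMap.zero_apply]
  · rw [hG j (by omega) b hb, map_zero]

theorem IsGradedCoalgebra.fixedPoint_unique {𝒟 : ℕ → Submodule k D} (h : IsGradedCoalgebra k 𝒟)
    {A : D →ₗ[k] X →ₗ[k] X} (hA : ∀ d ∈ 𝒟 0, A d = 0) {H G G' : D →ₗ[k] X}
    (hG : G = H + conv A G) (hG' : G' = H + conv A G') : G = G' := by
  have e : G - G' = conv A (G - G') := by
    rw [conv_sub_right]
    nth_rewrite 1 [hG, hG']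
    abel
  have key : ∀ n, ∀ d ∈ 𝒟 n, (G - G') d = 0 := by
    intro n
    induction n using Nat.strong_induction_on with
    | _ n ih =>
      intro d hd
      rw [e]
      exact h.conv_eq_zero hA ih hd
  rw [← sub_eq_zero]
  ext d
  exact h.isInternal.mem_of_forall_le (P := LinearMap.ker (G - G')) key d

theorem IsGradedCoalgebra.exists_fixedPoint {𝒟 : ℕ → Submodule k D} (h : IsGradedCoalgebra k 𝒟)
    {A : D →ₗ[k] X →ₗ[k] X} (hA : ∀ d ∈ 𝒟 0, A d = 0) (H : D →ₗ[k] X) :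
    ∃ G : D →ₗ[k] X, G = H + conv A G := by
  -- On degree `n`, the iterates of `G ↦ H + conv A G` are constant from the `(n + 1)`-st on.
  let T : ℕ → D →ₗ[k] X := fun N => (fun G => H + conv A G)^[N] 0
  have hT : ∀ N, T (N + 1) = H + conv A (T N) := fun N => Function.iterate_succ_apply' _ _ _
  have stable : ∀ n, ∀ N, n + 1 ≤ N → ∀ d ∈ 𝒟 n, T N d = T (n + 1) d := by
    intro n
    induction n using Nat.strong_induction_on with
    | _ n ih =>
      intro N hN d hd
      obtain ⟨M, rfl⟩ : ∃ M, N = M + 1 := ⟨N - 1, by omega⟩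
      rw [hT, hT, LinearMap.add_apply, LinearMap.add_apply, ← sub_eq_zero, add_sub_add_left_eq_sub,
        ← LinearMap.sub_apply, ← conv_sub_right]
      refine h.conv_eq_zero hA (fun j hj b hb => ?_) hd
      rw [LinearMap.sub_apply, ih j hj M (by omega) b hb, ih j hj n (by omega) b hb, sub_self]
  let G : D →ₗ[k] X := DirectSum.toModule k ℕ X (fun n => T (n + 1) ∘ₗ (𝒟 n).subtype) ∘ₗ
    (LinearEquiv.ofBijective (DirectSum.coeLinearMap 𝒟) h.isInternal).symm.toLinearMap
  have hG : ∀ n, ∀ d ∈ 𝒟 n, G d = T (n + 1) d := by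
    intro n d hd
    have : (LinearEquiv.ofBijective (DirectSum.coeLinearMap 𝒟) h.isInternal).symm d =
        DirectSum.lof k ℕ (fun i => 𝒟 i) n ⟨d, hd⟩ :=
      h.isInternal.symm_apply_of_mem hd
    simp only [G, LinearMap.comp_apply, LinearEquiv.coe_coe, this, DirectSum.toModule_lof,
      Submodule.subtype_apply]
  refine ⟨G, ?_⟩
  rw [← sub_eq_zero]
  ext d
  refine h.isInternal.mem_of_forall_le (P := LinearMap.ker (G - (H + conv A G)))
    (fun n d hd => ?_) d
  rw [LinearMap.mem_ker, LinearMap.sub_apply, hG n d hd, hT, LinearMap.add_apply,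
    LinearMap.add_apply, add_sub_add_left_eq_sub, ← LinearMap.sub_apply, ← conv_sub_right]
  refine h.conv_eq_zero hA (fun j hj b hb => ?_) hd
  rw [LinearMap.sub_apply, hG j b hb, stable j n (by omega) b hb, sub_self]

theorem IsGradedCoalgebra.fixedPoint_mem {𝒟 : ℕ → Submodule k D} (h : IsGradedCoalgebra k 𝒟)
    {A : D →ₗ[k] X →ₗ[k] X} (hA : ∀ d ∈ 𝒟 0, A d = 0) {H G : D →ₗ[k] X} (hG : G = H + conv A G)
    (𝒳 : ℕ → Submodule k X) (hH : ∀ n, ∀ d ∈ 𝒟 n, H d ∈ 𝒳 n)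
    (hAX : ∀ i j, ∀ d ∈ 𝒟 i, ∀ x ∈ 𝒳 j, A d x ∈ 𝒳 (i + j)) :
    ∀ n, ∀ d ∈ 𝒟 n, G d ∈ 𝒳 n := by
  intro n
  induction n using Nat.strong_induction_on with
  | _ n ih =>
    intro d hd
    rw [hG]
    refine add_mem (hH n d hd) (h.conv_mem hd fun i j hij a ha b hb => ?_)
    rcases Nat.eq_zero_or_pos i with rfl | hi
    · rw [hA a ha, LinearMap.zero_apply]
      exact zero_mem _
    · rw [← hij]
      exact hAX i j a ha _ (ih j (by omega) b hb)

end Convolution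

/-! ### The grafting product and primitive elements -/

namespace CompermSpace

open Coalgebra

variable (k : Type u) [Field k]

/-- The unit of the grafting product. -/
def one : CompermSpace k := basis k Comperm.empty

/-- The grafting product `F_c * F_d = F_{graft c d}`; it is unital, but not associative. -/
def mul : CompermSpace k →ₗ[k] CompermSpace k →ₗ[k] CompermSpace k :=
  (basis k).constr k fun c => (basis k).constr k fun d => basis k (c.graft d)

/-- The composite of the counit with the inclusion of the unit. -/
def unitCounit (D : Type v) [AddCommGroup D] [Module k D] [Coalgebra k D] :
    D →ₗ[k] CompermSpace k :=
  (counit : D →ₗ[k] k).smulRight (one k)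

theorem unitCounit_apply {D : Type v} [AddCommGroup D] [Module k D] [Coalgebra k D] (d : D) :
    unitCounit k D d = counit (R := k) d • one k := rfl

theorem mul_basis (c d : Comperm) : mul k (basis k c) (basis k d) = basis k (c.graft d) := by
  simp [mul]

theorem one_mul (x : CompermSpace k) : mul k (one k) x = x := by
  have : mul k (one k) = LinearMap.id :=
    (basis k).ext fun d => by rw [one, mul_basis, Comperm.empty_graft, LinearMap.id_apply]
  rw [this, LinearMap.id_apply]

theorem mul_one (x : CompermSpace k) : mul k x (one k) = x := by
  have : (mul k).flip (one k) = LinearMap.id := (basis k).ext fun d => by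
    rw [LinearMap.flip_apply, one, mul_basis, Comperm.graft_empty, LinearMap.id_apply]
  exact LinearMap.congr_fun this x

theorem counit_one : counit (R := k) (one k) = 1 := by
  rw [one, counit_basis, if_pos Comperm.weight_empty]

theorem comul_one : comul (R := k) (one k) = one k ⊗ₜ[k] one k := by
  rw [one, comul_basis, Comperm.weight_empty, Finset.sum_range_one, Comperm.tail_zero,
    Comperm.init_zero]

theorem counit_mul (x y : CompermSpace k) :
    counit (R := k) (mul k x y) = counit (R := k) x * counit (R := k) y := by
  have : (mul k).compr₂ counit =
      (LinearMap.mul k k).compl₁₂ (counit (R := k) (A := CompermSpace k)) counit := by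
    refine (basis k).ext fun c => (basis k).ext fun d => ?_
    simp only [LinearMap.compr₂_apply, mul_basis, counit_basis, LinearMap.compl₁₂_apply,
      LinearMap.mul_apply', Comperm.weight_graft, Nat.add_eq_zero_iff]
    split_ifs <;> simp_all
  exact LinearMap.congr_fun (LinearMap.congr_fun this x) y

/-- The compatibility of coproduct and product in a unital infinitesimal bialgebra. -/
theorem comul_mul (x y : CompermSpace k) :
    comul (R := k) (mul k x y) + x ⊗ₜ[k] y =
      ((mul k).flip y).lTensor (CompermSpace k) (comul (R := k) x) +
        (mul k x).rTensor (CompermSpace k) (comul (R := k) y) := by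
  have : (mul k).compr₂ comul + TensorProduct.mk k _ _ =
      ((LinearMap.lTensorHom (CompermSpace k) ∘ₗ (mul k).flip).flip ∘ₗ comul) +
        (LinearMap.rTensorHom (CompermSpace k) ∘ₗ mul k).compl₂ comul := by
    refine (basis k).ext fun c => (basis k).ext fun d => ?_
    simp only [LinearMap.add_apply, LinearMap.compr₂_apply, TensorProduct.mk_apply, mul_basis,
      LinearMap.comp_apply, LinearMap.flip_apply, LinearMap.compl₂_apply, comul_basis, map_sum,
      LinearMap.sum_apply, LinearMap.coe_lTensorHom, LinearMap.coe_rTensorHom,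
      LinearMap.lTensor_tmul, LinearMap.rTensor_tmul]
    -- The cut at `c.weight` is counted on both sides of the graft.
    rw [Comperm.weight_graft, add_assoc, Finset.sum_range_add, Finset.sum_range_succ _ c.weight,
      Comperm.init_weight, Comperm.tail_weight, Comperm.empty_graft, add_right_comm]
    refine congrArg₂ (· + ·) (congrArg (· + _) (Finset.sum_congr rfl fun p hp => ?_))
      (Finset.sum_congr rfl fun q _ => ?_)
    · have hp' := (Finset.mem_range.1 hp).le
      rw [Comperm.init_graft_of_le hp', Comperm.tail_graft_of_le hp']
    · rw [Comperm.init_graft_add, Comperm.tail_graft_add]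
  exact LinearMap.congr_fun (LinearMap.congr_fun this x) y

/-- The space of primitive elements. -/
def prim : Submodule k (CompermSpace k) :=
  LinearMap.eqLocus (comul (R := k))
    ((TensorProduct.mk k _ _).flip (one k) + TensorProduct.mk k _ _ (one k))

variable {k}

theorem mem_prim {x : CompermSpace k} :
    x ∈ prim k ↔ comul (R := k) x = x ⊗ₜ[k] one k + one k ⊗ₜ[k] x :=
  Iff.rfl

theorem counit_of_mem_prim {v : CompermSpace k} (hv : v ∈ prim k) : counit (R := k) v = 0 := by
  have h1 := rTensor_counit_comul (R := k) v
  rw [mem_prim.1 hv, map_add, LinearMap.rTensor_tmul, LinearMap.rTensor_tmul, counit_one,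
    add_eq_right] at h1
  have h2 := congrArg ((counit (R := k)) ∘ₗ (TensorProduct.lid k (CompermSpace k)).toLinearMap) h1
  simpa [counit_one] using h2

theorem comul_mul_of_mem_prim {v : CompermSpace k} (hv : v ∈ prim k) (y : CompermSpace k) :
    comul (R := k) (mul k v y) =
      one k ⊗ₜ[k] mul k v y + (mul k v).rTensor (CompermSpace k) (comul (R := k) y) := by
  have h := comul_mul k v y
  rw [mem_prim.1 hv, map_add, LinearMap.lTensor_tmul, LinearMap.lTensor_tmul,
    LinearMap.flip_apply, LinearMap.flip_apply, one_mul, add_comm, add_assoc] at h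
  exact add_left_cancel (h.trans (add_assoc _ _ _).symm |>.trans (by rw [add_assoc]))

theorem conv_basis {X Y : Type*} [AddCommGroup X] [Module k X] [AddCommGroup Y] [Module k Y]
    (A : CompermSpace k →ₗ[k] X →ₗ[k] Y) (G : CompermSpace k →ₗ[k] X) (c : Comperm) :
    conv A G (basis k c) =
      ∑ p ∈ Finset.range (c.weight + 1), A (basis k (c.init p)) (G (basis k (c.tail p))) := by
  simp [conv, comul_basis]

theorem conv_mul_of_mem_prim {X Y : Type*} [AddCommGroup X] [Module k X] [AddCommGroup Y]
    [Module k Y] {A : CompermSpace k →ₗ[k] X →ₗ[k] Y} (hA : A (one k) = 0)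
    (G : CompermSpace k →ₗ[k] X) {v : CompermSpace k} (hv : v ∈ prim k) (y : CompermSpace k) :
    conv A G (mul k v y) = conv (A ∘ₗ mul k v) G y := by
  have e : TensorProduct.lift ((A ∘ₗ mul k v).compl₂ G) =
      TensorProduct.lift (A.compl₂ G) ∘ₗ (mul k v).rTensor (CompermSpace k) :=
    TensorProduct.ext' fun a b => by simp
  simp [conv, e, comul_mul_of_mem_prim hv, hA]

/-! ### The projection onto the primitive elements -/

variable (k) in
/-- The value of the projection `primProj` at a basis element. -/
def primProjBasis (c : Comperm) : CompermSpace k :=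
  basis k c - counit (R := k) (basis k c) • one k -
    ∑ p : Fin c.weight, mul k (primProjBasis (c.init p)) (basis k (c.tail p))
termination_by c.weight
decreasing_by
  rw [Comperm.weight_init]
  omega

variable (k) in
/-- The projection `e` onto the primitive elements that is given by the recursion
`x = ε(x) 1 + ∑ e(x₁) * x₂`. -/
def primProj : CompermSpace k →ₗ[k] CompermSpace k := (basis k).constr k (primProjBasis k)

variable (k) in
theorem id_eq_conv_primProj :
    LinearMap.id = unitCounit k (CompermSpace k) + conv (mul k ∘ₗ primProj k) LinearMap.id := by
  refine (basis k).ext fun c => ?_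
  have hb : ∀ d, primProj k (basis k d) = primProjBasis k d := fun d => by simp [primProj]
  rw [LinearMap.add_apply, conv_basis, Finset.sum_range_succ, Comperm.init_weight,
    Comperm.tail_weight, LinearMap.comp_apply, LinearMap.id_apply, LinearMap.id_apply, hb,
    ← one, mul_one, primProjBasis, Finset.sum_range, unitCounit_apply]
  simp only [LinearMap.comp_apply, LinearMap.id_apply, hb]
  abel

theorem basis_eq_sum (c : Comperm) : basis k c = counit (R := k) (basis k c) • one k +
    ∑ p ∈ Finset.range (c.weight + 1),
      mul k (primProj k (basis k (c.init p))) (basis k (c.tail p)) := by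
  have h := LinearMap.congr_fun (id_eq_conv_primProj k) (basis k c)
  rwa [LinearMap.add_apply, conv_basis] at h

variable (k) in
theorem primProj_one : primProj k (one k) = 0 := by
  have h := basis_eq_sum (k := k) Comperm.empty
  rw [Comperm.weight_empty, zero_add, Finset.sum_range_one, Comperm.tail_zero,
    Comperm.init_zero, ← one, counit_one, one_smul, mul_one] at h
  exact add_eq_left.1 h.symm

theorem primProj_mul {v : CompermSpace k} (hv : v ∈ prim k) (y : CompermSpace k) :
    primProj k (mul k v y) = counit (R := k) y • v := by
  have hm : ∀ c : Comperm, mul k v (basis k c) = ∑ p ∈ Finset.range (c.weight + 1),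
      mul k (primProj k (mul k v (basis k (c.init p)))) (basis k (c.tail p)) := by
    intro c
    have h := LinearMap.congr_fun (id_eq_conv_primProj k) (mul k v (basis k c))
    rw [LinearMap.add_apply, unitCounit_apply, counit_mul, counit_of_mem_prim hv, zero_mul,
      zero_smul, zero_add, conv_mul_of_mem_prim (by simp [primProj_one]) _ hv, conv_basis] at h
    exact h
  have key : ∀ n, ∀ c : Comperm, c.weight = n →
      primProj k (mul k v (basis k c)) = counit (R := k) (basis k c) • v := by
    intro n
    induction n using Nat.strong_induction_on with
    | _ n ih =>
      rintro c rfl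
      have h := hm c
      rw [Finset.sum_range_succ, Comperm.init_weight, Comperm.tail_weight, ← one, mul_one] at h
      by_cases hc : c.weight = 0
      · rw [hc, Finset.sum_range_zero, zero_add, Comperm.eq_empty_iff.2 hc, ← one, mul_one] at h
        rw [Comperm.eq_empty_iff.2 hc, ← one, mul_one, counit_one, one_smul, ← h]
      · -- Only the cut at `0` contributes to the sum over the proper cuts.
        rw [Finset.sum_eq_single_of_mem 0 (by simp; omega), Comperm.init_zero, Comperm.tail_zero,
          ih 0 (by omega) _ Comperm.weight_empty, ← one, counit_one, one_smul] at h
        · rw [add_eq_left.1 h.symm, counit_basis, if_neg hc, zero_smul]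
        · intro p hp hp0
          have := Finset.mem_range.1 hp
          rw [ih p this _ (by rw [Comperm.weight_init]; omega), counit_basis,
            if_neg (by rw [Comperm.weight_init]; omega), zero_smul, map_zero,
            LinearMap.zero_apply]
  have : primProj k ∘ₗ mul k v = (counit (R := k)).smulRight v :=
    (basis k).ext fun c => key _ c rfl
  exact LinearMap.congr_fun this y

theorem primProj_of_mem_prim {v : CompermSpace k} (hv : v ∈ prim k) : primProj k v = v := by
  have := primProj_mul hv (one k)
  rwa [mul_one, counit_one, one_smul] at this

theorem primProj_mem_prim (x : CompermSpace k) : primProj k x ∈ prim k := by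
  have key : ∀ n, ∀ c : Comperm, c.weight = n → primProj k (basis k c) ∈ prim k := by
    intro n
    induction n using Nat.strong_induction_on with
    | _ n ih =>
      rintro c rfl
      by_cases hc : c.weight = 0
      · rw [Comperm.eq_empty_iff.2 hc, ← one, primProj_one]
        exact zero_mem _
      have heq := basis_eq_sum (k := k) c
      rw [Finset.sum_range_succ, Comperm.init_weight, Comperm.tail_weight, ← one, mul_one,
        counit_basis, if_neg hc, zero_smul, zero_add] at heq
      set S := ∑ p ∈ Finset.range c.weight,
        mul k (primProj k (basis k (c.init p))) (basis k (c.tail p)) with hS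
      -- The coproduct of the sum over the proper cuts, by induction.
      have hΔ : comul (R := k) S = one k ⊗ₜ[k] S + (∑ s ∈ Finset.range c.weight,
          basis k (c.init s) ⊗ₜ[k] basis k (c.tail s) - one k ⊗ₜ[k] basis k c +
            S ⊗ₜ[k] one k) := by
        have h1 : ∀ p ∈ Finset.range c.weight,
            comul (R := k) (mul k (primProj k (basis k (c.init p))) (basis k (c.tail p))) =
            one k ⊗ₜ[k] mul k (primProj k (basis k (c.init p))) (basis k (c.tail p)) +
            (∑ s ∈ Finset.Ico p c.weight,
              mul k (primProj k (basis k ((c.init s).init p)))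
                (basis k ((c.init s).tail p)) ⊗ₜ[k] basis k (c.tail s) +
              mul k (primProj k (basis k (c.init p))) (basis k (c.tail p)) ⊗ₜ[k] one k) := by
          intro p hp
          have hp' := Finset.mem_range.1 hp
          rw [comul_mul_of_mem_prim (ih p hp' _ (by rw [Comperm.weight_init]; omega)),
            comul_basis, map_sum, Comperm.weight_tail, Finset.sum_range_succ,
            ← Comperm.weight_tail, Comperm.init_weight, Comperm.tail_weight, ← one,
            LinearMap.rTensor_tmul, Finset.sum_Ico_eq_sum_range, Comperm.weight_tail]
          congr 2
          refine Finset.sum_congr rfl fun q _ => ?_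
          rw [LinearMap.rTensor_tmul, Comperm.tail_init, Comperm.init_init (Nat.le_add_right p q),
            Comperm.tail_tail]
        -- Summed over the first cut `p`, the terms with second cut `s` are the recursion for the
        -- part of `c` before `s`.
        have h2 : ∀ s ∈ Finset.range c.weight, ∑ p ∈ Finset.range (s + 1),
            mul k (primProj k (basis k ((c.init s).init p)))
              (basis k ((c.init s).tail p)) ⊗ₜ[k] basis k (c.tail s) =
            basis k (c.init s) ⊗ₜ[k] basis k (c.tail s) -
              counit (R := k) (basis k (c.init s)) • one k ⊗ₜ[k] basis k (c.tail s) := by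
          intro s hs
          have hs' : (c.init s).weight = s := by
            have := Finset.mem_range.1 hs
            rw [Comperm.weight_init]
            omega
          have h := basis_eq_sum (k := k) (c.init s)
          rw [hs'] at h
          rw [← TensorProduct.sum_tmul, TensorProduct.smul_tmul', ← TensorProduct.sub_tmul]
          exact congrArg (· ⊗ₜ[k] _) (eq_sub_of_add_eq' h.symm)
        have h3 : ∑ s ∈ Finset.range c.weight,
            counit (R := k) (basis k (c.init s)) • one k ⊗ₜ[k] basis k (c.tail s) =
            one k ⊗ₜ[k] basis k c := by
          rw [Finset.sum_eq_single_of_mem 0 (by simp; omega), Comperm.init_zero,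
            Comperm.tail_zero, ← one, counit_one, one_smul]
          intro s hs hs0
          have := Finset.mem_range.1 hs
          rw [counit_basis, if_neg (by rw [Comperm.weight_init]; omega), zero_smul]
        rw [hS, map_sum, Finset.sum_congr rfl h1, Finset.sum_add_distrib, Finset.sum_add_distrib,
          ← TensorProduct.tmul_sum, ← TensorProduct.sum_tmul, ← h3, ← Finset.sum_sub_distrib,
          ← Finset.sum_congr rfl h2]
        congr 2
        refine Finset.sum_comm' fun p s => ?_
        simp only [Finset.mem_range, Finset.mem_Ico]
        omega
      rw [mem_prim, eq_sub_of_add_eq' heq.symm, map_sub, hΔ, comul_basis, Finset.sum_range_succ,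
        Comperm.init_weight, Comperm.tail_weight, ← one, TensorProduct.sub_tmul,
        TensorProduct.tmul_sub]
      abel
  have : LinearMap.range (primProj k) ≤ prim k := by
    rw [LinearMap.range_eq_map, ← (basis k).span_eq, Submodule.map_span_le]
    rintro _ ⟨c, rfl⟩
    exact key _ c rfl
  exact this ⟨x, rfl⟩

end CompermSpace

/-! ### The two gradings -/

namespace CompermSpace

open Coalgebra

variable (k : Type u) [Field k]

theorem basis_mem_weightPart (c : Comperm) : basis k c ∈ weightPart k c.weight :=
  Submodule.subset_span ⟨c, rfl, rfl⟩

variable {k} in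
theorem weightPart_le {n : ℕ} {P : Submodule k (CompermSpace k)}
    (h : ∀ c : Comperm, c.weight = n → basis k c ∈ P) : weightPart k n ≤ P := by
  rw [weightPart, Submodule.span_le, Set.image_subset_iff]
  exact h

theorem isInternal_weightPart : DirectSum.IsInternal (weightPart k) := by
  let π : ℕ → CompermSpace k →ₗ[k] CompermSpace k := fun n =>
    (basis k).constr k fun c => if c.weight = n then basis k c else 0
  have hπ : ∀ n c, π n (basis k c) = if c.weight = n then basis k c else 0 := fun n c => by
    simp [π]
  refine DirectSum.isInternal_of_projections π (fun n x hx => ?_) (fun n m hnm x hx => ?_) ?_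
  · have : weightPart k n ≤ LinearMap.eqLocus (π n) LinearMap.id :=
      weightPart_le fun c hc => by simp [hπ, hc]
    exact this hx
  · have : weightPart k m ≤ LinearMap.ker (π n) :=
      weightPart_le fun c hc => by simp [hπ, hc, Ne.symm hnm]
    exact this hx
  · rw [eq_top_iff, ← (basis k).span_eq, Submodule.span_le]
    rintro _ ⟨c, rfl⟩
    exact Submodule.mem_iSup_of_mem c.weight (basis_mem_weightPart k c)

theorem isGradedCoalgebra_weightPart : IsGradedCoalgebra k (weightPart k) where
  isInternal := isInternal_weightPart k
  comul_mem n x hx := by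
    refine Submodule.mem_comap.1 (weightPart_le (fun c hc => ?_) hx)
    rw [Submodule.mem_comap, comul_basis]
    refine Submodule.sum_mem _ fun p hp => ?_
    have := Finset.mem_range.1 hp
    refine tmul_mem_iSup_antidiagonal ?_ (basis_mem_weightPart k _) (basis_mem_weightPart k _)
    rw [Comperm.weight_init, Comperm.weight_tail]
    omega
  counit_eq_zero n hn x hx :=
    LinearMap.mem_ker.1 (weightPart_le
      (fun c hc => by rw [LinearMap.mem_ker, counit_basis, if_neg (by omega)]) hx)

theorem one_mem_weightPart : one k ∈ weightPart k 0 := by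
  have := basis_mem_weightPart k Comperm.empty
  rwa [Comperm.weight_empty] at this

theorem mul_mem_weightPart {i j : ℕ} {x y : CompermSpace k} (hx : x ∈ weightPart k i)
    (hy : y ∈ weightPart k j) : mul k x y ∈ weightPart k (i + j) := by
  have : Submodule.map₂ (mul k) (weightPart k i) (weightPart k j) ≤ weightPart k (i + j) := by
    rw [weightPart, weightPart, Submodule.map₂_span_span, Submodule.span_le]
    rintro _ ⟨_, ⟨c, rfl, rfl⟩, _, ⟨d, rfl, rfl⟩, rfl⟩
    simp only [mul_basis, ← Comperm.weight_graft]
    exact basis_mem_weightPart k _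
  exact this (Submodule.apply_mem_map₂ _ hx hy)

theorem unitCounit_mem {D : Type v} [AddCommGroup D] [Module k D] [Coalgebra k D]
    {𝒟 : ℕ → Submodule k D} (h : IsGradedCoalgebra k 𝒟) {𝒞 : ℕ → Submodule k (CompermSpace k)}
    (h1 : one k ∈ 𝒞 0) (n : ℕ) (d : D) (hd : d ∈ 𝒟 n) : unitCounit k D d ∈ 𝒞 n := by
  rw [unitCounit_apply]
  rcases Nat.eq_zero_or_pos n with rfl | hn
  · exact Submodule.smul_mem _ _ h1
  · rw [h.counit_eq_zero n hn.ne' d hd, zero_smul]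
    exact zero_mem _

theorem primProj_mem_weightPart {n : ℕ} {x : CompermSpace k} (hx : x ∈ weightPart k n) :
    primProj k x ∈ weightPart k n := by
  refine Submodule.mem_comap.1 (weightPart_le ?_ hx)
  clear hx x
  induction n using Nat.strong_induction_on with
  | _ n ih =>
    rintro c rfl
    have h := basis_eq_sum (k := k) c
    rw [Finset.sum_range_succ, Comperm.init_weight, Comperm.tail_weight, ← one, mul_one,
      ← add_assoc] at h
    rw [Submodule.mem_comap, eq_sub_of_add_eq' h.symm]
    refine sub_mem (basis_mem_weightPart k c) (add_mem ?_ (Submodule.sum_mem _ fun p hp => ?_))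
    · exact unitCounit_mem k (isGradedCoalgebra_weightPart k) (one_mem_weightPart k) _ _
        (basis_mem_weightPart k c)
    · have hp' := Finset.mem_range.1 hp
      have := mul_mem_weightPart k (ih p hp' (c.init p) (by rw [Comperm.weight_init]; omega))
        (basis_mem_weightPart k (c.tail p))
      rwa [Comperm.weight_tail, Nat.add_sub_cancel' hp'.le] at this

/-- The grading by the number of primitive factors: the component of degree `n` is spanned by the
right-normed products `v₁ * (v₂ * (⋯ * vₙ))` of primitive elements. -/
def primGrading : ℕ → Submodule k (CompermSpace k)
  | 0 => Submodule.span k {one k}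
  | n + 1 => Submodule.map₂ (mul k) (prim k) (primGrading n)

/-- The projection onto the component of degree `n` of `primGrading`. -/
def primGradingProj : ℕ → CompermSpace k →ₗ[k] CompermSpace k
  | 0 => unitCounit k (CompermSpace k)
  | n + 1 => conv (mul k ∘ₗ primProj k) (primGradingProj n)

theorem one_mem_primGrading : one k ∈ primGrading k 0 := Submodule.mem_span_singleton_self _

theorem mul_mem_primGrading {n : ℕ} {v y : CompermSpace k} (hv : v ∈ prim k)
    (hy : y ∈ primGrading k n) : mul k v y ∈ primGrading k (n + 1) :=
  Submodule.apply_mem_map₂ _ hv hy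

variable {k} in
theorem primGrading_succ_le {n : ℕ} {P : Submodule k (CompermSpace k)}
    (h : ∀ v ∈ prim k, ∀ y ∈ primGrading k n, mul k v y ∈ P) : primGrading k (n + 1) ≤ P :=
  Submodule.map₂_le.2 h

theorem primGrading_one : primGrading k 1 = prim k := by
  refine le_antisymm (primGrading_succ_le fun v hv y hy => ?_) fun v hv => ?_
  · obtain ⟨a, rfl⟩ := Submodule.mem_span_singleton.1 hy
    rw [map_smul, mul_one]
    exact Submodule.smul_mem _ _ hv
  · rw [← mul_one k v]
    exact mul_mem_primGrading k hv (one_mem_primGrading k)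

variable {k} in
theorem primGradingProj_succ_mul (n : ℕ) {v : CompermSpace k} (hv : v ∈ prim k)
    (y : CompermSpace k) :
    primGradingProj k (n + 1) (mul k v y) = mul k v (primGradingProj k n y) := by
  rw [primGradingProj, conv_mul_of_mem_prim (by simp [primProj_one]) _ hv]
  exact LinearMap.congr_fun (conv_eq_of_counit_left (g := mul k v ∘ₗ primGradingProj k n)
    fun a b => by simp [primProj_mul hv]) y

theorem primGradingProj_succ_one (n : ℕ) : primGradingProj k (n + 1) (one k) = 0 := by
  simp [primGradingProj, conv, comul_one, primProj_one]

theorem primGradingProj_one : primGradingProj k 1 = primProj k :=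
  conv_eq_of_counit_right fun a b => by
    simp [primGradingProj, unitCounit_apply, mul_one]

theorem primGradingProj_of_mem (n : ℕ) :
    ∀ x ∈ primGrading k n, primGradingProj k n x = x := by
  induction n with
  | zero =>
    intro x hx
    obtain ⟨a, rfl⟩ := Submodule.mem_span_singleton.1 hx
    rw [map_smul, primGradingProj, unitCounit_apply, counit_one, one_smul]
  | succ n ih =>
    refine fun x hx => primGrading_succ_le (P := LinearMap.eqLocus (primGradingProj k (n + 1))
      LinearMap.id) (fun v hv y hy => ?_) hx
    rw [LinearMap.mem_eqLocus, primGradingProj_succ_mul n hv, ih y hy, LinearMap.id_apply]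

theorem primGradingProj_of_mem_of_ne (n : ℕ) :
    ∀ m, n ≠ m → ∀ x ∈ primGrading k m, primGradingProj k n x = 0 := by
  induction n with
  | zero =>
    intro m hm x hx
    obtain ⟨m, rfl⟩ := Nat.exists_eq_succ_of_ne_zero hm.symm
    refine LinearMap.mem_ker.1 (primGrading_succ_le (fun v hv y hy => ?_) hx)
    rw [LinearMap.mem_ker, primGradingProj, unitCounit_apply, counit_mul, counit_of_mem_prim hv,
      zero_mul, zero_smul]
  | succ n ih =>
    rintro (_ | m) hm x hx
    · obtain ⟨a, rfl⟩ := Submodule.mem_span_singleton.1 hx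
      rw [map_smul, primGradingProj_succ_one, smul_zero]
    · refine LinearMap.mem_ker.1 (primGrading_succ_le (fun v hv y hy => ?_) hx)
      rw [LinearMap.mem_ker, primGradingProj_succ_mul n hv, ih m (by omega) y hy, map_zero]

theorem iSup_primGrading : ⨆ n, primGrading k n = ⊤ := by
  have hmul : ∀ v ∈ prim k, ∀ y ∈ ⨆ n, primGrading k n, mul k v y ∈ ⨆ n, primGrading k n := by
    intro v hv y hy
    refine iSup_le (a := Submodule.comap (mul k v) (⨆ n, primGrading k n)) (fun n y hy => ?_) hy
    exact Submodule.mem_iSup_of_mem (n + 1) (mul_mem_primGrading k hv hy)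
  have key : ∀ n, ∀ c : Comperm, c.weight = n → basis k c ∈ ⨆ n, primGrading k n := by
    intro n
    induction n using Nat.strong_induction_on with
    | _ n ih =>
      rintro c rfl
      rw [basis_eq_sum c]
      refine add_mem (Submodule.smul_mem _ _
        (Submodule.mem_iSup_of_mem 0 (one_mem_primGrading k))) (Submodule.sum_mem _ fun p hp => ?_)
      rcases Nat.eq_zero_or_pos p with rfl | hp0
      · rw [Comperm.init_zero, ← one, primProj_one, map_zero]
        exact zero_mem _
      · have := Finset.mem_range.1 hp
        exact hmul _ (primProj_mem_prim _) _ (ih (c.weight - p) (by omega) _ (c.weight_tail p))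
  rw [eq_top_iff, ← (basis k).span_eq, Submodule.span_le]
  rintro _ ⟨c, rfl⟩
  exact key _ c rfl

theorem isInternal_primGrading : DirectSum.IsInternal (primGrading k) :=
  DirectSum.isInternal_of_projections (primGradingProj k) (primGradingProj_of_mem k)
    (primGradingProj_of_mem_of_ne k) (iSup_primGrading k)

theorem isGradedCoalgebra_primGrading : IsGradedCoalgebra k (primGrading k) where
  isInternal := isInternal_primGrading k
  comul_mem n := by
    induction n with
    | zero =>
      intro x hx
      obtain ⟨a, rfl⟩ := Submodule.mem_span_singleton.1 hx
      rw [map_smul, comul_one]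
      exact Submodule.smul_mem _ _ (tmul_mem_iSup_antidiagonal (Nat.zero_add 0)
        (one_mem_primGrading k) (one_mem_primGrading k))
    | succ n ih =>
      refine fun x hx => Submodule.mem_comap.1 (primGrading_succ_le (fun v hv y hy => ?_) hx)
      rw [Submodule.mem_comap, comul_mul_of_mem_prim hv]
      refine add_mem (tmul_mem_iSup_antidiagonal (Nat.zero_add _) (one_mem_primGrading k)
        (mul_mem_primGrading k hv hy)) ?_
      refine Submodule.mem_comap.1 (iSup_antidiagonal_le (P := Submodule.comap
        ((mul k v).rTensor (CompermSpace k)) _) (fun i j hij a ha b hb => ?_) (ih y hy))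
      rw [Submodule.mem_comap, LinearMap.rTensor_tmul]
      exact tmul_mem_iSup_antidiagonal (by omega) (mul_mem_primGrading k hv ha) hb
  counit_eq_zero n hn x hx := by
    obtain ⟨n, rfl⟩ := Nat.exists_eq_succ_of_ne_zero hn
    refine LinearMap.mem_ker.1 (primGrading_succ_le (fun v hv y hy => ?_) hx)
    rw [LinearMap.mem_ker, counit_mul, counit_of_mem_prim hv, zero_mul]

theorem primGradingProj_mem (n : ℕ) (x : CompermSpace k) :
    primGradingProj k n x ∈ primGrading k n := by
  refine (isInternal_primGrading k).mem_of_forall_le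
    (P := Submodule.comap (primGradingProj k n) (primGrading k n)) (fun m y hy => ?_) x
  rw [Submodule.mem_comap]
  by_cases h : n = m
  · subst h
    rwa [primGradingProj_of_mem k n y hy]
  · rw [primGradingProj_of_mem_of_ne k n m h y hy]
    exact zero_mem _

theorem primGradingProj_mem_weightPart (n : ℕ) :
    ∀ m, ∀ x ∈ weightPart k m, primGradingProj k n x ∈ weightPart k m := by
  induction n with
  | zero =>
    exact unitCounit_mem k (isGradedCoalgebra_weightPart k) (one_mem_weightPart k)
  | succ n ih =>
    intro m x hx
    refine (isGradedCoalgebra_weightPart k).conv_mem hx fun i j hij a ha b hb => ?_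
    rw [← hij]
    exact mul_mem_weightPart k (primProj_mem_weightPart k ha) (ih j b hb)

theorem iSup_primGrading_inf_weightPart (n : ℕ) :
    ⨆ m, primGrading k n ⊓ weightPart k m = primGrading k n := by
  refine le_antisymm (iSup_le fun m => inf_le_left) fun x hx => ?_
  rw [← primGradingProj_of_mem k n x hx]
  refine (isInternal_weightPart k).mem_of_forall_le
    (P := Submodule.comap (primGradingProj k n) (⨆ m, primGrading k n ⊓ weightPart k m))
    (fun m y hy => ?_) x
  exact Submodule.mem_iSup_of_mem m
    ⟨primGradingProj_mem k n y, primGradingProj_mem_weightPart k n m y hy⟩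

theorem subtype_comp_gradedProj_primGrading (h : DirectSum.IsInternal (primGrading k)) :
    (primGrading k 1).subtype ∘ₗ gradedProj (primGrading k) h 1 = primProj k := by
  rw [← primGradingProj_one]
  exact gradedProj_eq h (primGradingProj_of_mem k 1) (primGradingProj_of_mem_of_ne k 1)

/-! ### The universal property -/

section Lift

variable {k} {D : Type w} [AddCommGroup D] [Module k D] [Coalgebra k D] {𝒟 : ℕ → Submodule k D}

/-- A coalgebra morphism `φ` is determined by `f = e ∘ φ`, through the recursion
`φ(d) = ε(d) 1 + ∑ f(d₁) * φ(d₂)`. -/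
theorem coalgHom_eq_conv (φ : D →ₗc[k] CompermSpace k) :
    (φ : D →ₗ[k] CompermSpace k) = unitCounit k D +
      conv (mul k ∘ₗ primProj k ∘ₗ (φ : D →ₗ[k] CompermSpace k)) (φ : D →ₗ[k] CompermSpace k) := by
  have h := congrArg (· ∘ₗ (φ : D →ₗ[k] CompermSpace k)) (id_eq_conv_primProj k)
  simp only [LinearMap.add_comp, conv_comp_coalgHom, LinearMap.id_comp] at h
  have hu : unitCounit k (CompermSpace k) ∘ₗ (φ : D →ₗ[k] CompermSpace k) = unitCounit k D := by
    ext d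
    simp [unitCounit_apply]
  rwa [hu] at h

/-- Every solution of the recursion `φ(d) = ε(d) 1 + ∑ f(d₁) * φ(d₂)` with primitive values of `f`
preserves the counits. -/
theorem counit_comp_of_eq_conv {f φ : D →ₗ[k] CompermSpace k} (hf : ∀ d, f d ∈ prim k)
    (hφ : φ = unitCounit k D + conv (mul k ∘ₗ f) φ) : counit ∘ₗ φ = counit (R := k) := by
  have h0 : counit ∘ₗ conv (mul k ∘ₗ f) φ = 0 := by
    rw [comp_conv]
    exact conv_eq_of_counit_left fun a b => by simp [counit_mul, counit_of_mem_prim (hf a)]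
  rw [hφ, LinearMap.comp_add, h0, add_zero]
  ext d
  simp [unitCounit_apply, counit_one]

theorem primProj_comp_of_eq_conv {f φ : D →ₗ[k] CompermSpace k} (hf : ∀ d, f d ∈ prim k)
    (hφ : φ = unitCounit k D + conv (mul k ∘ₗ f) φ) : primProj k ∘ₗ φ = f := by
  have hu : primProj k ∘ₗ unitCounit k D = 0 := by
    ext d
    simp [unitCounit_apply, primProj_one]
  rw [hφ, LinearMap.comp_add, hu, zero_add, comp_conv]
  refine conv_eq_of_counit_right fun a b => ?_
  have := LinearMap.congr_fun (counit_comp_of_eq_conv hf hφ) b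
  rw [LinearMap.comp_apply] at this
  simp [primProj_mul (hf a), this]

/-- The two sides solve the same recursion
`G(d) = 1 ⊗ φ(d) + ∑ (f(d₁) * -) ⊗ id (G(d₂))`. -/
theorem map_comp_comul_of_eq_conv (h : IsGradedCoalgebra k 𝒟) {f φ : D →ₗ[k] CompermSpace k}
    (hf : ∀ d, f d ∈ prim k) (hf0 : ∀ d ∈ 𝒟 0, f d = 0)
    (hφ : φ = unitCounit k D + conv (mul k ∘ₗ f) φ) :
    TensorProduct.map φ φ ∘ₗ comul = comul ∘ₗ φ := by
  refine h.fixedPoint_unique (A := LinearMap.rTensorHom (CompermSpace k) ∘ₗ mul k ∘ₗ f)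
    (H := TensorProduct.mk k _ _ (one k) ∘ₗ φ) (fun d hd => by simp [hf0 d hd]) ?_ ?_
  · have h1 : conv (TensorProduct.mk k _ _ ∘ₗ unitCounit k D) φ =
        TensorProduct.mk k _ _ (one k) ∘ₗ φ :=
      conv_eq_of_counit_left fun a b => by simp [unitCounit_apply]
    rw [map_comp_comul_eq_conv]
    nth_rewrite 1 [hφ]
    rw [LinearMap.comp_add, conv_add_left, h1, conv_mk_conv]
  · have h1 : comul ∘ₗ unitCounit k D =
        TensorProduct.mk k _ _ (one k) ∘ₗ unitCounit k D := by
      ext d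
      simp [unitCounit_apply, comul_one]
    have h2 : comul ∘ₗ conv (mul k ∘ₗ f) φ =
        TensorProduct.mk k _ _ (one k) ∘ₗ conv (mul k ∘ₗ f) φ +
          conv (LinearMap.rTensorHom (CompermSpace k) ∘ₗ mul k ∘ₗ f) (comul ∘ₗ φ) := by
      rw [comp_conv, comp_conv, conv, conv, conv, ← LinearMap.add_comp]
      congr 1
      exact TensorProduct.ext' fun a b => by simp [comul_mul_of_mem_prim (hf a)]
    nth_rewrite 1 [hφ]
    rw [LinearMap.comp_add, h1, h2, ← add_assoc, ← LinearMap.comp_add, ← hφ]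

/-- The universal property, for any grading that contains `1` in degree `0` and is compatible with
left multiplication by the values of `f`. -/
theorem existsUnique_coalgHom (h : IsGradedCoalgebra k 𝒟) {f : D →ₗ[k] CompermSpace k}
    (hf : ∀ d, f d ∈ prim k) (hf0 : ∀ d ∈ 𝒟 0, f d = 0)
    {𝒞 : ℕ → Submodule k (CompermSpace k)} (h1 : one k ∈ 𝒞 0)
    (hmul : ∀ i j, ∀ d ∈ 𝒟 i, ∀ x ∈ 𝒞 j, mul k (f d) x ∈ 𝒞 (i + j)) :
    ∃! φ : D →ₗc[k] CompermSpace k,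
      IsGradedHom 𝒟 𝒞 φ ∧ primProj k ∘ₗ (φ : D →ₗ[k] CompermSpace k) = f := by
  have hA : ∀ d ∈ 𝒟 0, (mul k ∘ₗ f) d = 0 := fun d hd => by simp [hf0 d hd]
  obtain ⟨φ, hφ⟩ := h.exists_fixedPoint hA (unitCounit k D)
  refine ⟨{ φ with
    counit_comp := counit_comp_of_eq_conv hf hφ
    map_comp_comul := map_comp_comul_of_eq_conv h hf hf0 hφ }, ⟨?_, ?_⟩, ?_⟩
  · exact h.fixedPoint_mem hA hφ 𝒞 (unitCounit_mem k h h1) hmul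
  · exact primProj_comp_of_eq_conv hf hφ
  · rintro ψ ⟨-, hψ⟩
    have e := coalgHom_eq_conv ψ
    rw [hψ] at e
    have := h.fixedPoint_unique hA e hφ
    ext d
    exact LinearMap.congr_fun this d

end Lift

theorem comp_gradedProj_eq_iff {D : Type w} [AddCommGroup D] [Module k D]
    (h : DirectSum.IsInternal (primGrading k)) (φ : D →ₗ[k] CompermSpace k)
    (f : D →ₗ[k] primGrading k 1) :
    gradedProj (primGrading k) h 1 ∘ₗ φ = f ↔
      primProj k ∘ₗ φ = (primGrading k 1).subtype ∘ₗ f := by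
  rw [← subtype_comp_gradedProj_primGrading k h, LinearMap.comp_assoc,
    LinearMap.cancel_left (Submodule.injective_subtype _)]

theorem isCofreeGradedCoalgebra_primGrading :
    IsCofreeGradedCoalgebra.{u, u, w} k (primGrading k) := by
  refine ⟨isGradedCoalgebra_primGrading k, fun D _ _ _ 𝒟 hD f hf => ?_⟩
  refine (existsUnique_congr fun φ =>
    and_congr_right fun _ => comp_gradedProj_eq_iff k _ _ f).2 ?_
  have hp : ∀ d, ((primGrading k 1).subtype ∘ₗ f) d ∈ prim k := fun d => by
    rw [← primGrading_one]
    exact (f d).2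
  refine existsUnique_coalgHom hD hp (fun d hd => ?_) (one_mem_primGrading k)
    fun i j d hd x hx => ?_
  · rw [LinearMap.comp_apply, hf 0 zero_ne_one d hd, map_zero]
  · by_cases hi : i = 1
    · subst hi
      rw [add_comm]
      exact mul_mem_primGrading k (hp d) hx
    · rw [LinearMap.comp_apply, hf i hi d hd, map_zero, map_zero, LinearMap.zero_apply]
      exact zero_mem _

theorem isCofreeGradedCoalgebraOver_weightPart (h : DirectSum.IsInternal (primGrading k)) :
    IsCofreeGradedCoalgebraOver.{u, u, w} k (weightPart k) (primGrading k 1)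
      (gradedProj (primGrading k) h 1) := by
  refine ⟨isGradedCoalgebra_weightPart k, fun D _ _ _ 𝒟 hD f hf => ?_⟩
  refine (existsUnique_congr fun φ =>
    and_congr_right fun _ => comp_gradedProj_eq_iff k _ _ f).2 ?_
  have hp : ∀ d, ((primGrading k 1).subtype ∘ₗ f) d ∈ prim k := fun d => by
    rw [← primGrading_one]
    exact (f d).2
  refine existsUnique_coalgHom hD hp (fun d hd => ?_) (one_mem_weightPart k)
    fun i j d hd x hx => mul_mem_weightPart k (hf i d hd) hx
  -- The only primitive element of weight `0` is `0`.
  have h0 : weightPart k 0 ≤ LinearMap.ker (primProj k) := weightPart_le fun c hc => by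
    rw [LinearMap.mem_ker, Comperm.eq_empty_iff.2 hc, ← one, primProj_one]
  exact (primProj_of_mem_prim (hp d)).symm.trans (LinearMap.mem_ker.1 (h0 (hf 0 d hd)))

end CompermSpace

end

theorem mainTheorem4 (k : Type u) [Field k] [CharZero k] :
    ∃ (𝒞 : ℕ → Submodule k (CompermSpace k)) (h : DirectSum.IsInternal 𝒞),
      (∀ n : ℕ, ⨆ m : ℕ, 𝒞 n ⊓ CompermSpace.weightPart k m = 𝒞 n) ∧
      IsCofreeGradedCoalgebra.{u, u, w} k 𝒞 ∧
      IsCofreeGradedCoalgebraOver.{u, u, w} k (CompermSpace.weightPart k) (𝒞 1)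
        (gradedProj 𝒞 h 1) :=
  ⟨CompermSpace.primGrading k, CompermSpace.isInternal_primGrading k,
    CompermSpace.iSup_primGrading_inf_weightPart k,
    CompermSpace.isCofreeGradedCoalgebra_primGrading k,
    CompermSpace.isCofreeGradedCoalgebraOver_weightPart k _⟩
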